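/- **Setting.** Let $(\mathsf D,\mathfrak m)$ be a finite measure space and $\mathbb H=L^2(\mathsf D,\mathfrak m)$ with norm $|\cdot|$. Let $\mathbb V$ be a real Hilbert space densely and compactly embedded in $\mathbb H$, and let $\mathcal E:\mathbb V\times\mathbb V\to\mathbb R$ be a continuous symmetric bilinear form such that, writing $\mathcal E(u)=\mathcal E(u,u)$ and for constants $\alpha\ge 0$, $M>0$, $$\mathcal E(u)\ge\alpha|u|^2,\qquad M^{-1}\|u\|_{\mathbb V}^2\le \mathcal E(u)+|u|^2\le M\|u\|_{\mathbb V}^2\qquad\text{for every }u\in\mathbb V.$$ Let $\theta\ge 0$, $V_{\min}\in\mathbb R$, and let $\mathscr K:\mathbb H\to(-\infty,+\infty]$ be lower semicontinuous with nonempty proper domain $\mathbb K=\{V:\mathscr K(V)<+\infty\}$, such that $\mathscr K_\theta(V):=\mathscr K(V)+\frac\theta2|V|^2$ is convex and every $V\in\mathbb K$ satisfies $V\ge V_{\min}$ a.e. Put $$\mathbb K[c]:=\{V\in\mathbb K:\ |V|\le c,\ \mathscr K_\theta(V)\le c\},$$ fix $V_o\in\mathbb K$ and let $c_o:=\max(|V_o|,\mathscr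 K_\theta(V_o))$. For $V\in\mathbb K$ let $D(\mathcal E_V):=\{u\in\mathbb V:\int_{\mathsf D} V_+u^2\,d\mathfrak m<\infty\}$. A $(V,\lambda)$-eigenfunction is a $u\in D(\mathcal E_V)\setminus\{0\}$ with $\mathcal E(u,v)+\int_{\mathsf D} Vuv\,d\mathfrak m=\lambda\int_{\mathsf D} uv\,d\mathfrak m$ for every $v\in D(\mathcal E_V)$; it is normalized if $|u|=1$. Fix $J\in\mathbb N$ and suppose that $\dim D(\mathcal E_V)\ge J$ for every $V\in\mathbb K$ (for example, that $D(\mathcal E_V)$ is infinite dimensional), so that the first $J$ eigenvalues $\lambda_1(V)\le\dots\le\lambda_J(V)$, repeated according to multiplicity, exist. Let $\boldsymbol U^J(V)$ be the set of all $(u_1,\dots,u_J)$, orthonormal in $\mathbb H$, in which $u_i$ is a $(V,\lambda_i(V))$-eigenfunction, and let $\mathbf U^J[c]:=\bigcup_{V\in\mathbb K[c]}\boldsymbol U^J(V)$. Suppose finally that for $V\in\mathbb K$ every $(V,\lambda)$-eigenfunction belongs to $L^4(\mathsf D,\mathfrak m)$ and that, for every $c\ge c_o$ and $\bar\lambda>\alpha+V_{\min}$,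 the set of normalized $(V,\lambda)$-eigenfunctions with $V\in\mathbb K[c]$ and $\lambda\le\bar\lambda$ is relatively compact in $L^4(\mathsf D,\mathfrak m)$. **Statement.** Let $1\le k\le J$ and $\sigma_k:=\lambda_1+\dots+\lambda_k$ on $\mathbb K$. Then: 1. $\lambda_k$ and $\sigma_k$ are sequentially weakly continuous on $\mathbb K$: if $V_n,V\in\mathbb K$ and $V_n\rightharpoonup V$ weakly in $\mathbb H$, then $\lambda_k(V_n)\to\lambda_k(V)$ and $\sigma_k(V_n)\to\sigma_k(V)$. 2. $\sigma_k$ is concave on $\mathbb K$. 3. For every $c\ge c_o$, $\lambda_k$ and $\sigma_k$ are Lipschitz on $\mathbb K[c]$ with respect to $|\cdot|$. 4. For every $c\ge c_o$ the set $\mathbf U^J[c]$ is nonempty, contained in $(\mathbb V\cap L^4(\mathsf D,\mathfrak m))^J$ and compact there (for convergence in both $\mathbb V$ and $L^4$). The minimum in $$\sigma_{k,c}(V):=\min\Big\{\sum_{h=1}^k\Big(\mathcal E(w_h)+\int_{\mathsf D} V w_h^2\,d\mathfrak m\Big):\ \boldsymbol w\in\mathbf U^J[c]\Big\}$$ is attained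 for every $V\in\mathbb H$; the function $\sigma_{k,c}:\mathbb H\to\mathbb R$ is concave and globally Lipschitz; $\sigma_{k,c}\ge\sigma_k$ on $\mathbb K$, and $\sigma_{k,c}=\sigma_k$ on $\mathbb K[c]$. -/

import Mathlib

open MeasureTheory Filter Topology Set
open scoped ENNReal NNReal

namespace SchrodingerEigen

/-- Needed for the norm of `L⁴`. -/
instance fact_one_le_four : Fact ((1 : ℝ≥0∞) ≤ 4) := ⟨by norm_num⟩

section Form

variable {D : Type*} [MeasurableSpace D] {m : Measure D}
  {𝕍 : Type*} [NormedAddCommGroup 𝕍] [InnerProductSpace ℝ 𝕍]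

/-- The domain `D(ℰ_V) = {u ∈ 𝕍 : ∫ V₊ u² dm < ∞}`, where the abstract Hilbert space `𝕍` is
regarded as a subspace of `L²(D, m)` through the embedding `ι`. -/
noncomputable def formDomain (ι : 𝕍 →L[ℝ] Lp ℝ 2 m) (V : Lp ℝ 2 m) : Submodule ℝ 𝕍 where
  carrier := {u | Integrable (fun x => max (V x) 0 * (ι u x) ^ 2) m}
  zero_mem' := by
    have h : (fun x => max (V x) 0 * (ι (0 : 𝕍) x) ^ 2) =ᵐ[m] fun _ => (0 : ℝ) := by
      rw [map_zero]
      filter_upwards [Lp.coeFn_zero ℝ 2 m] with x hx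
      rw [hx]
      simp
    exact (integrable_congr h).2 (integrable_zero _ _ _)
  add_mem' := by
    intro u v hu hv
    have hu' : Integrable (fun x => max (V x) 0 * (ι u x) ^ 2) m := hu
    have hv' : Integrable (fun x => max (V x) 0 * (ι v x) ^ 2) m := hv
    have hV : AEStronglyMeasurable (fun x => max (V x) 0) m :=
      (Lp.aestronglyMeasurable V).sup aestronglyMeasurable_const
    refine ((hu'.const_mul 2).add (hv'.const_mul 2)).mono'
      (hV.mul ((Lp.aestronglyMeasurable (ι (u + v))).pow 2)) ?_
    have hadd := Lp.coeFn_add (ι u) (ι v)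
    rw [← map_add] at hadd
    filter_upwards [hadd] with x hx
    have h0 : 0 ≤ max (V x) 0 := le_max_right _ _
    have hn : 0 ≤ max (V x) 0 * (ι (u + v) x) ^ 2 := mul_nonneg h0 (sq_nonneg _)
    rw [Real.norm_of_nonneg hn, hx]
    simp only [Pi.add_apply]
    nlinarith [mul_nonneg h0 (sq_nonneg (ι u x - ι v x))]
  smul_mem' := by
    intro a u hu
    have hu' : Integrable (fun x => max (V x) 0 * (ι u x) ^ 2) m := hu
    have hs := Lp.coeFn_smul a (ι u)
    rw [← map_smul] at hs
    have h : (fun x => max (V x) 0 * (ι (a • u) x) ^ 2) =ᵐ[m]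
        fun x => a ^ 2 * (max (V x) 0 * (ι u x) ^ 2) := by
      filter_upwards [hs] with x hx
      rw [hx]
      simp only [Pi.smul_apply, smul_eq_mul]
      ring
    exact (integrable_congr h).2 (hu'.const_mul _)

/-- `u` is a `(V, lam)`-eigenfunction: `u ∈ D(ℰ_V)`, `u ≠ 0` and
`ℰ(u, v) + ∫ V u v dm = lam ∫ u v dm` for every `v ∈ D(ℰ_V)`. -/
def IsEigenfunction (ι : 𝕍 →L[ℝ] Lp ℝ 2 m) (E : 𝕍 →L[ℝ] 𝕍 →L[ℝ] ℝ)
    (V : Lp ℝ 2 m) (lam : ℝ) (u : 𝕍) : Prop :=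
  u ∈ formDomain ι V ∧ u ≠ 0 ∧ ∀ v ∈ formDomain ι V,
    E u v + ∫ x, V x * ι u x * ι v x ∂m = lam * ∫ x, ι u x * ι v x ∂m

/-- The `k`-th eigenvalue `λ_k(V)`, `k = 1, 2, …`, in increasing order and repeated according to
multiplicity: the least `t` such that there are `k` linearly independent eigenfunctions of `ℰ_V`
with eigenvalues at most `t`. -/
noncomputable def eigenvalue (ι : 𝕍 →L[ℝ] Lp ℝ 2 m) (E : 𝕍 →L[ℝ] 𝕍 →L[ℝ] ℝ)
    (k : ℕ) (V : Lp ℝ 2 m) : ℝ :=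
  sInf {t : ℝ | ∃ u : Fin k → 𝕍, LinearIndependent ℝ u ∧
    ∀ i, ∃ μ ≤ t, IsEigenfunction ι E V μ (u i)}

/-- `σ_k(V) = λ_1(V) + … + λ_k(V)`. -/
noncomputable def eigenvalueSum (ι : 𝕍 →L[ℝ] Lp ℝ 2 m) (E : 𝕍 →L[ℝ] 𝕍 →L[ℝ] ℝ)
    (k : ℕ) (V : Lp ℝ 2 m) : ℝ :=
  ∑ h ∈ Finset.Icc 1 k, eigenvalue ι E h V

/-- `𝐔^J(V)`: the systems `(u_1, …, u_J)`, orthonormal in `L²`, of eigenfunctions associated with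
`λ_1(V), …, λ_J(V)`. The entry `u i`, `i : Fin J`, belongs to `λ_{i+1}(V)`. -/
def eigenSystems (ι : 𝕍 →L[ℝ] Lp ℝ 2 m) (E : 𝕍 →L[ℝ] 𝕍 →L[ℝ] ℝ)
    (J : ℕ) (V : Lp ℝ 2 m) : Set (Fin J → 𝕍) :=
  {u | (∀ i : Fin J, IsEigenfunction ι E V (eigenvalue ι E (i.val + 1) V) (u i) ∧ ‖ι (u i)‖ = 1) ∧
    ∀ i j : Fin J, i ≠ j → ∫ x, ι (u i) x * ι (u j) x ∂m = 0}

end Form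

section Potentials

variable {D : Type*} [MeasurableSpace D] {m : Measure D}
  {𝕍 : Type*} [NormedAddCommGroup 𝕍] [InnerProductSpace ℝ 𝕍]

/-- The proper domain `𝕂 = {V : 𝒦(V) < +∞}`. -/
def properDomain (𝒦 : Lp ℝ 2 m → EReal) : Set (Lp ℝ 2 m) := {V | 𝒦 V < ⊤}

/-- `𝒦_θ(V) = 𝒦(V) + (θ/2) |V|²`. -/
noncomputable def penalized (𝒦 : Lp ℝ 2 m → EReal) (θ : ℝ) (V : Lp ℝ 2 m) : EReal :=
  𝒦 V + ((θ / 2 * ‖V‖ ^ 2 : ℝ) : EReal)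

/-- `-θ`-convexity of a functional with values in `(-∞, +∞]`: `𝒦_θ` is convex, that is, its
proper domain is convex and it is a convex real function there. -/
def IsSemiconvex (𝒦 : Lp ℝ 2 m → EReal) (θ : ℝ) : Prop :=
  ConvexOn ℝ (properDomain 𝒦) (fun V => (penalized 𝒦 θ V).toReal)

/-- `𝕂[c] = {V ∈ 𝕂 : |V| ≤ c, 𝒦_θ(V) ≤ c}`. -/
def boundedPotentials (𝒦 : Lp ℝ 2 m → EReal) (θ c : ℝ) : Set (Lp ℝ 2 m) :=
  {V | V ∈ properDomain 𝒦 ∧ ‖V‖ ≤ c ∧ penalized 𝒦 θ V ≤ (c : EReal)}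

/-- `U[c, Λ]`: the normalized `(V, lam)`-eigenfunctions with `V ∈ 𝕂[c]` and `lam ≤ Λ`. -/
def boundedEigenfunctions (ι : 𝕍 →L[ℝ] Lp ℝ 2 m) (E : 𝕍 →L[ℝ] 𝕍 →L[ℝ] ℝ)
    (𝒦 : Lp ℝ 2 m → EReal) (θ c Λ : ℝ) : Set 𝕍 :=
  {u | ‖ι u‖ = 1 ∧ ∃ V ∈ boundedPotentials 𝒦 θ c, ∃ lam ≤ Λ, IsEigenfunction ι E V lam u}

/-- `𝐔^J[c]`: the union of the sets `𝐔^J(V)` over `V ∈ 𝕂[c]`. -/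
def boundedEigenSystems (ι : 𝕍 →L[ℝ] Lp ℝ 2 m) (E : 𝕍 →L[ℝ] 𝕍 →L[ℝ] ℝ)
    (𝒦 : Lp ℝ 2 m → EReal) (θ : ℝ) (J : ℕ) (c : ℝ) : Set (Fin J → 𝕍) :=
  ⋃ V ∈ boundedPotentials 𝒦 θ c, eigenSystems ι E J V

/-- The set `𝐔^J[c]` inside `(𝕍 ∩ L⁴)^J`, where an element of `𝕍 ∩ L⁴` is recorded as the pair
formed by itself as an element of `𝕍` and of its class in `L⁴`; thus the topology is the one of
convergence both in `𝕍` and in `L⁴`. -/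
def boundedEigenSystemsL4 (ι : 𝕍 →L[ℝ] Lp ℝ 2 m) (E : 𝕍 →L[ℝ] 𝕍 →L[ℝ] ℝ)
    (𝒦 : Lp ℝ 2 m → EReal) (θ : ℝ) (J : ℕ) (c : ℝ) : Set (Fin J → 𝕍 × Lp ℝ 4 m) :=
  {p | (fun i => (p i).1) ∈ boundedEigenSystems ι E 𝒦 θ J c ∧
    ∀ i, ((p i).2 : D → ℝ) =ᵐ[m] ι (p i).1}

/-- `∑_{h ≤ k} (ℰ(w_h) + ∫ V w_h² dm)`, the sum being over the first `k` entries of a system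
`(w_1, …, w_J)`. -/
noncomputable def partialEnergy (ι : 𝕍 →L[ℝ] Lp ℝ 2 m) (E : 𝕍 →L[ℝ] 𝕍 →L[ℝ] ℝ)
    {J : ℕ} (k : ℕ) (V : Lp ℝ 2 m) (w : Fin J → 𝕍) : ℝ :=
  ∑ i ∈ Finset.univ.filter (fun i : Fin J => i.val < k), (E (w i) (w i) + ∫ x, V x * (ι (w i) x) ^ 2 ∂m)

/-- `σ_{k,c}(V)`, the infimum of `∑_{h ≤ k} (ℰ(w_h) + ∫ V w_h² dm)` over `w ∈ 𝐔^J[c]`. -/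
noncomputable def truncatedSum (ι : 𝕍 →L[ℝ] Lp ℝ 2 m) (E : 𝕍 →L[ℝ] 𝕍 →L[ℝ] ℝ)
    (𝒦 : Lp ℝ 2 m → EReal) (θ : ℝ) (J k : ℕ) (c : ℝ) (V : Lp ℝ 2 m) : ℝ :=
  sInf (partialEnergy ι E k V '' boundedEigenSystems ι E 𝒦 θ J c)

/-- Weak convergence `V_n ⇀ V` in `L²(D, m)`. -/
def WeakTendsto (Vn : ℕ → Lp ℝ 2 m) (V : Lp ℝ 2 m) : Prop :=
  ∀ f : Lp ℝ 2 m, Tendsto (fun n => inner ℝ f (Vn n)) atTop (𝓝 (inner ℝ f V))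

/-- Weak (sequential) continuity on a set `K` of a function on `L²(D, m)`. -/
def WeaklyContinuousOn (F : Lp ℝ 2 m → ℝ) (K : Set (Lp ℝ 2 m)) : Prop :=
  ∀ (Vn : ℕ → Lp ℝ 2 m) (V : Lp ℝ 2 m), (∀ n, Vn n ∈ K) → V ∈ K → WeakTendsto Vn V →
    Tendsto (fun n => F (Vn n)) atTop (𝓝 (F V))

end Potentials

end SchrodingerEigen

open SchrodingerEigen

/-! The core is Ky Fan's principle: `σ_k(V)` is the least value of `∑ (ℰ(w_h) + ∫ V w_h²)` over
`L²`-orthonormal systems in the form domain (`IsMinimizingSystem.sum_le`,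
`CoerciveForm.eigenvalueSum_le`). Eigenfunctions lie in `L⁴`, so their squares are in `L²`. A system
of eigenfunctions of one potential is therefore a competitor for every other potential, and its
energy is an affine continuous function of `V`. Thus `σ_k` is a minimum of affine functions, hence
concave; a uniform `L⁴` bound on `𝕂[c]` makes their slopes bounded, hence the Lipschitz estimates.
The function `σ_{k,c}` is the same minimum with competitors restricted to `𝐔^J[c]`, and `λ_k = σ_k -
σ_{k-1}`.

Weak continuity is a sandwich (`CoerciveForm.exists_limit_eigenSystem`). A fixed system of the limit
potential bounds the limit of `σ_k(V_n)` from above. From below, systems of `V_n` have weak limits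
in `𝕍`, strong in `L²`, and the energy is lower semicontinuous under joint convergence of potential
and function (`integral_mul_sq_le_of_weakLimit`). Equality for all `k ≤ J` forces equality term by
term, so the limits are again eigenfunctions.

For compactness of `𝐔^J[c]`, the set `𝕂[c]` is convex, closed and bounded, so its potentials have
weak limits inside it. Relative compactness gives `L⁴` convergence of the eigenfunctions, hence
convergence of the potential energies, then of `ℰ`, then strong convergence in `𝕍` by coercivity.
Limits are taken along ultrafilters, which replaces the extraction of subsequences. -/

namespace SchrodingerEigen

/-! ### Algebraic spectral theory of a symmetric form: successive minimizers and Ky Fan's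
inequality. -/

section FormOnVectorSpace

variable {W H : Type*} [AddCommGroup W] [Module ℝ W] [NormedAddCommGroup H]
  [InnerProductSpace ℝ H] {κ : Type*}

/-- `u` is an eigenvector of the form `B`, relative to the inner product pulled back along `j`. -/
def IsEigenvector (j : W →ₗ[ℝ] H) (B : W →ₗ[ℝ] W →ₗ[ℝ] ℝ) (μ : ℝ) (u : W) : Prop :=
  u ≠ 0 ∧ ∀ v, B u v = μ * inner ℝ (j u) (j v)

/-- The `k`-th eigenvalue of the form `B`, counted with multiplicity. -/
noncomputable def spectralValue (j : W →ₗ[ℝ] H) (B : W →ₗ[ℝ] W →ₗ[ℝ] ℝ) (k : ℕ) : ℝ :=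
  sInf {t : ℝ | ∃ u : Fin k → W, LinearIndependent ℝ u ∧
    ∀ i, ∃ μ ≤ t, IsEigenvector j B μ (u i)}

/-- `v` is orthogonal to the vectors `e a`, `a ∈ s`. -/
def OrthTo (j : W →ₗ[ℝ] H) (s : Finset κ) (e : κ → W) (v : W) : Prop :=
  ∀ a ∈ s, inner ℝ (j (e a)) (j v) = 0

/-- `u` is a normalized minimizer of the Rayleigh quotient of `B` among the vectors
orthogonal to `e a`, `a ∈ s`. -/
def IsConstrainedMinimizer (j : W →ₗ[ℝ] H) (B : W →ₗ[ℝ] W →ₗ[ℝ] ℝ) (s : Finset κ) (e : κ → W)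
    (u : W) : Prop :=
  ‖j u‖ = 1 ∧ OrthTo j s e u ∧ ∀ v, OrthTo j s e v → B u u * ‖j v‖ ^ 2 ≤ B v v

/-- Every successive minimization problem for the Rayleigh quotient has a solution, as soon as
there is a nonzero competitor. -/
def HasMinimizers (j : W →ₗ[ℝ] H) (B : W →ₗ[ℝ] W →ₗ[ℝ] ℝ) : Prop :=
  ∀ (n : ℕ) (e : ℕ → W), (∃ u ≠ 0, OrthTo j (Finset.range n) e u) →
    ∃ u, IsConstrainedMinimizer j B (Finset.range n) e u

/-- The first `n` vectors of `u` are successive minimizers of the Rayleigh quotient. -/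
def IsMinimizingSystem (j : W →ₗ[ℝ] H) (B : W →ₗ[ℝ] W →ₗ[ℝ] ℝ) (n : ℕ) (u : ℕ → W) : Prop :=
  ∀ i < n, IsConstrainedMinimizer j B (Finset.range i) u (u i)

/-- The vectors `e a`, `a ∈ s`, are orthonormal. -/
def OrthonormalFor (j : W →ₗ[ℝ] H) (s : Finset κ) (e : κ → W) : Prop :=
  (∀ a ∈ s, ‖j (e a)‖ = 1) ∧ ∀ a ∈ s, ∀ b ∈ s, a ≠ b → inner ℝ (j (e a)) (j (e b)) = 0

theorem OrthonormalFor.mono {j : W →ₗ[ℝ] H} {s t : Finset κ} {e : κ → W}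
    (h : OrthonormalFor j s e) (hts : t ⊆ s) : OrthonormalFor j t e :=
  ⟨fun a ha => h.1 a (hts ha), fun a ha b hb => h.2 a (hts ha) b (hts hb)⟩

theorem OrthonormalFor.inner_self {j : W →ₗ[ℝ] H} {s : Finset κ} {e : κ → W}
    (h : OrthonormalFor j s e) {a : κ} (ha : a ∈ s) : inner ℝ (j (e a)) (j (e a)) = (1 : ℝ) := by
  rw [real_inner_self_eq_norm_sq, h.1 a ha, one_pow]

/-- The first variation at a minimum vanishes: the discriminant of the quadratic polynomial in `t`
is at most zero. -/
theorem eq_zero_of_forall_quadratic_nonneg {a b : ℝ} (h : ∀ t : ℝ, 0 ≤ 2 * t * a + t ^ 2 * b) :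
    a = 0 := by
  have := discrim_le_zero (a := b) (b := 2 * a) (c := 0) fun t => by nlinarith [h t]
  rw [discrim] at this
  nlinarith [sq_nonneg a]

/-- The component of `v` orthogonal to the vectors `e a`, `a ∈ s`. -/
noncomputable def residual (j : W →ₗ[ℝ] H) (s : Finset κ) (e : κ → W) (v : W) : W :=
  v - ∑ a ∈ s, inner ℝ (j (e a)) (j v) • e a

theorem OrthonormalFor.orthTo_residual {j : W →ₗ[ℝ] H} {s : Finset κ} {e : κ → W}
    (h : OrthonormalFor j s e) (v : W) : OrthTo j s e (residual j s e v) := by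
  intro a ha
  rw [residual, map_sub, map_sum, inner_sub_right, inner_sum, Finset.sum_eq_single_of_mem a ha]
  · rw [map_smul, inner_smul_right, h.inner_self ha]; ring
  · intro b hb hba
    rw [map_smul, inner_smul_right, h.2 a ha b hb hba.symm, mul_zero]

/-- The form of a vector, in terms of the coefficients on an orthonormal system of eigenvectors and
of the residual. -/
theorem OrthonormalFor.form_eq {j : W →ₗ[ℝ] H} {B : W →ₗ[ℝ] W →ₗ[ℝ] ℝ}
    (hB : ∀ u v, B u v = B v u) {s : Finset κ} {e : κ → W} (h : OrthonormalFor j s e)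
    {μ : κ → ℝ} (he : ∀ a ∈ s, IsEigenvector j B (μ a) (e a)) (v : W) :
    B v v = B (residual j s e v) (residual j s e v) +
      ∑ a ∈ s, μ a * inner ℝ (j (e a)) (j v) ^ 2 := by
  set r := residual j s e v with hr
  have hv : v = r + ∑ a ∈ s, inner ℝ (j (e a)) (j v) • e a := by rw [hr, residual]; abel
  have hro : OrthTo j s e r := h.orthTo_residual v
  have h1 : ∀ a ∈ s, B (e a) v = μ a * inner ℝ (j (e a)) (j v) := fun a ha => (he a ha).2 v
  have h2 : ∀ a ∈ s, B r (e a) = 0 := fun a ha => by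
    rw [hB, (he a ha).2, hro a ha, mul_zero]
  have h3 : B r v = B r r := by
    conv_lhs => rw [hv]
    rw [map_add, map_sum, Finset.sum_eq_zero, add_zero]
    intro a ha
    rw [map_smul, h2 a ha, smul_zero]
  conv_lhs => enter [1, 2]; rw [hv]
  rw [map_add, LinearMap.add_apply, h3, map_sum, LinearMap.sum_apply]
  congr 1
  refine Finset.sum_congr rfl fun a ha => ?_
  rw [map_smul, LinearMap.smul_apply, h1 a ha, smul_eq_mul]; ring

theorem OrthonormalFor.norm_sq_eq {j : W →ₗ[ℝ] H} {s : Finset κ} {e : κ → W}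
    (h : OrthonormalFor j s e) (v : W) :
    ‖j v‖ ^ 2 = ‖j (residual j s e v)‖ ^ 2 + ∑ a ∈ s, inner ℝ (j (e a)) (j v) ^ 2 := by
  set r := residual j s e v with hr
  have hv : v = r + ∑ a ∈ s, inner ℝ (j (e a)) (j v) • e a := by rw [hr, residual]; abel
  have hro : OrthTo j s e r := h.orthTo_residual v
  have h3 : inner ℝ (j r) (j v) = inner ℝ (j r) (j r) := by
    conv_lhs => rw [hv]
    rw [map_add, inner_add_right, map_sum, inner_sum, Finset.sum_eq_zero, add_zero]
    intro a ha
    rw [map_smul, inner_smul_right, real_inner_comm (j (e a)) (j r), hro a ha, mul_zero]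
  rw [← real_inner_self_eq_norm_sq, ← real_inner_self_eq_norm_sq]
  conv_lhs => enter [2]; rw [hv]
  rw [map_add, inner_add_left, h3, map_sum, sum_inner]
  congr 1
  refine Finset.sum_congr rfl fun a ha => ?_
  rw [map_smul, real_inner_smul_left]; ring

/-- Perturbing `u` to `u + t r` gives the Euler–Lagrange equation only for `r` orthogonal to the
constraints. It extends to every test vector because the `e a` are themselves eigenvectors
orthogonal to `u`, so both sides vanish on them. -/
theorem IsConstrainedMinimizer.isEigenvector {j : W →ₗ[ℝ] H} {B : W →ₗ[ℝ] W →ₗ[ℝ] ℝ}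
    (hB : ∀ u v, B u v = B v u) {s : Finset κ} {e : κ → W} (h : OrthonormalFor j s e)
    (he : ∀ a ∈ s, ∃ μ, IsEigenvector j B μ (e a)) {u : W}
    (hu : IsConstrainedMinimizer j B s e u) : IsEigenvector j B (B u u) u := by
  obtain ⟨hu1, huo, humin⟩ := hu
  refine ⟨fun h0 => by simp [h0] at hu1, fun v => ?_⟩
  have key : ∀ r, OrthTo j s e r → B u r = B u u * inner ℝ (j u) (j r) := by
    intro r hr
    refine sub_eq_zero.1 (eq_zero_of_forall_quadratic_nonneg
      (b := B r r - B u u * ‖j r‖ ^ 2) fun t => ?_)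
    have := humin (u + t • r) fun a ha => by
      rw [map_add, map_smul, inner_add_right, inner_smul_right, huo a ha, hr a ha]; ring
    rw [map_add, map_smul, norm_add_sq_real, hu1, norm_smul, inner_smul_right, mul_pow,
      Real.norm_eq_abs, sq_abs] at this
    simp only [map_add, map_smul, LinearMap.add_apply, LinearMap.smul_apply, smul_eq_mul] at this
    rw [hB r u] at this
    nlinarith
  have hv : v = residual j s e v + ∑ a ∈ s, inner ℝ (j (e a)) (j v) • e a := by
    rw [residual]; abel
  have hz1 : B u (∑ a ∈ s, inner ℝ (j (e a)) (j v) • e a) = 0 := by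
    rw [map_sum]
    refine Finset.sum_eq_zero fun a ha => ?_
    obtain ⟨μ, hμ⟩ := he a ha
    rw [map_smul, hB, hμ.2, huo a ha, mul_zero, smul_zero]
  have hz2 : inner ℝ (j u) (j (∑ a ∈ s, inner ℝ (j (e a)) (j v) • e a)) = (0 : ℝ) := by
    rw [map_sum, inner_sum]
    refine Finset.sum_eq_zero fun a ha => ?_
    rw [map_smul, inner_smul_right, real_inner_comm (j (e a)) (j u), huo a ha, mul_zero]
  rw [hv, map_add, hz1, map_add, inner_add_right, hz2, key _ (h.orthTo_residual v)]
  ring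

theorem IsMinimizingSystem.orthonormalFor {j : W →ₗ[ℝ] H} {B : W →ₗ[ℝ] W →ₗ[ℝ] ℝ} {n : ℕ}
    {u : ℕ → W} (h : IsMinimizingSystem j B n u) : OrthonormalFor j (Finset.range n) u := by
  refine ⟨fun a ha => (h a (Finset.mem_range.1 ha)).1, fun a ha b hb hab => ?_⟩
  rw [Finset.mem_range] at ha hb
  rcases lt_or_gt_of_ne hab with hlt | hlt
  · exact (h b hb).2.1 a (Finset.mem_range.2 hlt)
  · rw [real_inner_comm]; exact (h a ha).2.1 b (Finset.mem_range.2 hlt)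

theorem IsMinimizingSystem.mono {j : W →ₗ[ℝ] H} {B : W →ₗ[ℝ] W →ₗ[ℝ] ℝ} {n k : ℕ}
    {u : ℕ → W} (h : IsMinimizingSystem j B n u) (hk : k ≤ n) : IsMinimizingSystem j B k u :=
  fun i hi => h i (hi.trans_le hk)

theorem IsMinimizingSystem.isEigenvector {j : W →ₗ[ℝ] H} {B : W →ₗ[ℝ] W →ₗ[ℝ] ℝ}
    (hB : ∀ u v, B u v = B v u) {n : ℕ} {u : ℕ → W} (h : IsMinimizingSystem j B n u) {i : ℕ}
    (hi : i < n) : IsEigenvector j B (B (u i) (u i)) (u i) := by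
  induction i using Nat.strong_induction_on with
  | _ i ih =>
    refine (h i hi).isEigenvector hB (h.mono hi.le).orthonormalFor fun a ha => ⟨_, ih a ?_ ?_⟩
    · exact Finset.mem_range.1 ha
    · exact (Finset.mem_range.1 ha).trans hi

theorem IsMinimizingSystem.monotone {j : W →ₗ[ℝ] H} {B : W →ₗ[ℝ] W →ₗ[ℝ] ℝ} {n : ℕ}
    {u : ℕ → W} (h : IsMinimizingSystem j B n u) {i l : ℕ} (hil : i ≤ l) (hl : l < n) :
    B (u i) (u i) ≤ B (u l) (u l) := by
  have := (h i (hil.trans_lt hl)).2.2 (u l) fun a ha =>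
    (h l hl).2.1 a (Finset.mem_range.2 ((Finset.mem_range.1 ha).trans_le hil))
  rwa [(h l hl).1, one_pow, mul_one] at this

/-- Fewer than `J` linear conditions on a space of dimension at least `J` cannot define an injective
map. -/
theorem exists_ne_zero_orthTo (j : W →ₗ[ℝ] H) {n J : ℕ} (hJ : (J : Cardinal) ≤ Module.rank ℝ W)
    (hn : n < J) (e : ℕ → W) : ∃ u ≠ 0, OrthTo j (Finset.range n) e u := by
  let T : W →ₗ[ℝ] (Fin n → ℝ) := LinearMap.pi fun i => (innerₗ H (j (e i))).comp j
  by_contra! hcon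
  have hT : Function.Injective T := by
    rw [injective_iff_map_eq_zero]
    intro u hu
    by_contra hu0
    refine hcon u hu0 fun a ha => ?_
    simpa [T] using congrFun hu ⟨a, Finset.mem_range.1 ha⟩
  have h1 := LinearMap.lift_rank_le_of_injective T hT
  have h2 : Cardinal.lift.{_} (Module.rank ℝ (Fin n → ℝ)) = (n : Cardinal) := by simp
  rw [h2] at h1
  have h3 : Module.rank ℝ W ≤ n := by simpa using h1
  have := hJ.trans h3
  rw [Nat.cast_le] at this
  omega

theorem HasMinimizers.exists_isMinimizingSystem {j : W →ₗ[ℝ] H} {B : W →ₗ[ℝ] W →ₗ[ℝ] ℝ}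
    (h : HasMinimizers j B) {J : ℕ} (hJ : (J : Cardinal) ≤ Module.rank ℝ W) :
    ∃ u, IsMinimizingSystem j B J u := by
  suffices ∀ n ≤ J, ∃ u, IsMinimizingSystem j B n u from this J le_rfl
  intro n
  induction n with
  | zero => exact fun _ => ⟨0, fun i hi => absurd hi (Nat.not_lt_zero i)⟩
  | succ n ih =>
    intro hn
    obtain ⟨u, hu⟩ := ih (Nat.le_of_succ_le hn)
    obtain ⟨v, hv⟩ := h n u (exists_ne_zero_orthTo j hJ hn u)
    -- The constraint at stage `i` involves only entries of index below `i`, so changing the `n`-th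
    -- entry leaves the earlier stages intact.
    have hcongr : ∀ i ≤ n, ∀ x, OrthTo j (Finset.range i) (Function.update u n v) x ↔
        OrthTo j (Finset.range i) u x := by
      intro i hi x
      refine forall₂_congr fun a ha => ?_
      rw [Function.update_of_ne]
      have := Finset.mem_range.1 ha
      omega
    refine ⟨Function.update u n v, fun i hi => ?_⟩
    have hin : i ≤ n := Nat.lt_succ_iff.1 hi
    have hx : IsConstrainedMinimizer j B (Finset.range i) u (Function.update u n v i) := by
      rcases hin.eq_or_lt with rfl | hlt
      · simpa using hv
      · rw [Function.update_of_ne hlt.ne]; exact hu i hlt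
    exact ⟨hx.1, (hcongr i hin _).2 hx.2.1, fun w hw => hx.2.2 w ((hcongr i hin w).1 hw)⟩

theorem OrthonormalFor.linearIndependent {j : W →ₗ[ℝ] H} {n : ℕ} {u : ℕ → W}
    (h : OrthonormalFor j (Finset.range n) u) :
    LinearIndependent ℝ fun i : Fin n => u i := by
  have : Orthonormal ℝ fun i : Fin n => j (u i) :=
    ⟨fun i => h.1 i (Finset.mem_range.2 i.2), fun i l hil => h.2 i (Finset.mem_range.2 i.2) l
      (Finset.mem_range.2 l.2) fun h => hil (Fin.ext h)⟩
  exact LinearIndependent.of_comp j this.linearIndependent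

/-- The eigenvalues are the values of the successive minimization problems. -/
theorem IsMinimizingSystem.spectralValue_eq {j : W →ₗ[ℝ] H} (hj : Function.Injective j)
    {B : W →ₗ[ℝ] W →ₗ[ℝ] ℝ}
    (hB : ∀ u v, B u v = B v u) {n : ℕ} {u : ℕ → W} (h : IsMinimizingSystem j B n u) {i : ℕ}
    (hi : i < n) : spectralValue j B (i + 1) = B (u i) (u i) := by
  have hlb : B (u i) (u i) ∈ lowerBounds {t : ℝ | ∃ u : Fin (i + 1) → W, LinearIndependent ℝ u ∧
      ∀ l, ∃ μ ≤ t, IsEigenvector j B μ (u l)} := by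
    rintro t ⟨v, hv, hvt⟩
    by_contra! hlt
    have ho : OrthonormalFor j (Finset.range i) u := (h.mono hi.le).orthonormalFor
    -- An eigenvector with eigenvalue below `B (u i) (u i)` must lie in the span of `u 0, …, u (i -
    -- 1)`, which cannot contain `i + 1` independent vectors. Its residual `r` satisfies `B r r = μ
    -- ‖j r‖²`, and minimality of `u i` then forces `r = 0`.
    have hspan : ∀ l, v l ∈ Submodule.span ℝ (u '' Finset.range i) := by
      intro l
      obtain ⟨μ, hμt, hμ⟩ := hvt l
      set r := residual j (Finset.range i) u (v l) with hr
      have hro : OrthTo j (Finset.range i) u r := ho.orthTo_residual _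
      have hvr : v l = r + ∑ a ∈ Finset.range i, inner ℝ (j (u a)) (j (v l)) • u a := by
        rw [hr, residual]; abel
      have hz : ∀ a ∈ Finset.range i, B (u a) r = 0 := fun a ha => by
        rw [(h.isEigenvector hB ((Finset.mem_range.1 ha).trans hi)).2, hro a ha, mul_zero]
      have h1 : B r r = B (v l) r := by
        conv_rhs => rw [hvr]
        rw [map_add, LinearMap.add_apply, map_sum, LinearMap.sum_apply, Finset.sum_eq_zero,
          add_zero]
        intro a ha
        rw [map_smul, LinearMap.smul_apply, hz a ha, smul_zero]
      have h2 : inner ℝ (j (v l)) (j r) = ‖j r‖ ^ 2 := by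
        rw [← real_inner_self_eq_norm_sq]
        conv_lhs => rw [hvr]
        rw [map_add, inner_add_left, map_sum, sum_inner, Finset.sum_eq_zero, add_zero]
        intro a ha
        rw [map_smul, real_inner_smul_left, hro a ha, mul_zero]
      have h3 := (h i hi).2.2 r hro
      rw [h1, hμ.2, h2] at h3
      have h4 : ‖j r‖ ^ 2 = 0 := by nlinarith [sq_nonneg ‖j r‖]
      have h5 : r = 0 := by
        have : j r = 0 := by simpa using h4
        exact (map_eq_zero_iff j hj).1 this
      rw [hvr, h5, zero_add]
      exact Submodule.sum_mem _ fun a ha => Submodule.smul_mem _ _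
        (Submodule.subset_span ⟨a, ha, rfl⟩)
    classical
    have hle := linearIndependent_le_span_aux' v hv (((Finset.range i).image u : Finset W) : Set W)
      (by rw [Finset.coe_image]; rintro _ ⟨l, rfl⟩; exact hspan l)
    simp only [Finset.coe_sort_coe, Fintype.card_coe, Fintype.card_fin] at hle
    have := hle.trans Finset.card_image_le
    rw [Finset.card_range] at this
    omega
  refine le_antisymm (csInf_le ⟨_, hlb⟩ ⟨fun l => u l, ?_, fun l => ?_⟩) (le_csInf ?_ hlb)
  · exact (h.mono hi).orthonormalFor.linearIndependent
  · have hl := Nat.lt_succ_iff.1 l.2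
    exact ⟨_, h.monotone hl hi, h.isEigenvector hB (hl.trans_lt hi)⟩
  · refine ⟨B (u i) (u i), fun l => u l, ?_, fun l => ?_⟩
    · exact (h.mono hi).orthonormalFor.linearIndependent
    · have hl := Nat.lt_succ_iff.1 l.2
      exact ⟨_, h.monotone hl hi, h.isEigenvector hB (hl.trans_lt hi)⟩

theorem OrthonormalFor.sum_inner_sq_le {j : W →ₗ[ℝ] H} {s : Finset κ} {e : κ → W}
    (h : OrthonormalFor j s e) (v : W) :
    ∑ a ∈ s, inner ℝ (j (e a)) (j v) ^ 2 ≤ ‖j v‖ ^ 2 := by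
  rw [h.norm_sq_eq v]
  exact le_add_of_nonneg_left (sq_nonneg _)

/-- Ky Fan's inequality. -/
theorem IsMinimizingSystem.sum_le {j : W →ₗ[ℝ] H} {B : W →ₗ[ℝ] W →ₗ[ℝ] ℝ}
    (hB : ∀ u v, B u v = B v u) {n : ℕ} {u : ℕ → W} (h : IsMinimizingSystem j B n u)
    {s : Finset κ} {w : κ → W} (hw : OrthonormalFor j s w) (hs : s.card = n) :
    ∑ i ∈ Finset.range n, B (u i) (u i) ≤ ∑ a ∈ s, B (w a) (w a) := by
  rcases n.eq_zero_or_pos with rfl | hn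
  · rw [Finset.card_eq_zero] at hs
    simp [hs]
  have hln : n - 1 < n := Nat.sub_lt hn one_pos
  set lam := B (u (n - 1)) (u (n - 1)) with hlam
  have ho := h.orthonormalFor
  -- Expand `w a` on the eigenvectors; the residual has Rayleigh quotient at least the last value
  -- `lam`, and the unit norm of `w a` expresses its mass through the coefficients.
  have h1 : ∀ a ∈ s, lam + ∑ i ∈ Finset.range n,
      (B (u i) (u i) - lam) * inner ℝ (j (u i)) (j (w a)) ^ 2 ≤ B (w a) (w a) := by
    intro a ha
    rw [ho.form_eq hB (fun i hi => h.isEigenvector hB (Finset.mem_range.1 hi)) (w a)]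
    have h2 := ho.norm_sq_eq (w a)
    rw [hw.1 a ha, one_pow] at h2
    have h3 := (h (n - 1) hln).2.2 _ fun b hb => ho.orthTo_residual (w a) b
      (Finset.mem_range.2 ((Finset.mem_range.1 hb).trans hln))
    simp only [sub_mul, Finset.sum_sub_distrib, ← Finset.mul_sum]
    rw [← hlam] at h3
    have h6 := congrArg (lam * ·) h2
    simp only [mul_add, mul_one] at h6
    linarith
  have h4 : ∑ a ∈ s, (lam + ∑ i ∈ Finset.range n,
      (B (u i) (u i) - lam) * inner ℝ (j (u i)) (j (w a)) ^ 2) =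
      n * lam + ∑ i ∈ Finset.range n, (B (u i) (u i) - lam) *
        ∑ a ∈ s, inner ℝ (j (w a)) (j (u i)) ^ 2 := by
    rw [Finset.sum_add_distrib, Finset.sum_const, hs, nsmul_eq_mul, Finset.sum_comm]
    simp only [Finset.mul_sum, real_inner_comm]
  refine le_trans ?_ (h4.symm.le.trans (Finset.sum_le_sum h1))
  have h5 : ∑ i ∈ Finset.range n, B (u i) (u i) =
      n * lam + ∑ i ∈ Finset.range n, (B (u i) (u i) - lam) * 1 := by
    simp [Finset.sum_sub_distrib]
  rw [h5]
  refine add_le_add_right (Finset.sum_le_sum fun i hi => ?_) _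
  have hi' := Finset.mem_range.1 hi
  -- Each weight `B (u i) (u i) - lam` is nonpositive, so Bessel's bound by `1`, now for `u i`
  -- against the system `w`, goes in the needed direction.
  refine mul_le_mul_of_nonpos_left ?_ (sub_nonpos.2 (h.monotone (by omega) hln))
  have := hw.sum_inner_sq_le (u i)
  rwa [(h i hi').1, one_pow] at this

theorem sum_spectralValue_le {j : W →ₗ[ℝ] H} (hj : Function.Injective j)
    {B : W →ₗ[ℝ] W →ₗ[ℝ] ℝ} (hB : ∀ u v, B u v = B v u) {J : ℕ} {u : ℕ → W}
    (h : IsMinimizingSystem j B J u) {s : Finset κ} {w : κ → W} (hw : OrthonormalFor j s w)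
    (hs : s.card ≤ J) :
    ∑ i ∈ Finset.range s.card, spectralValue j B (i + 1) ≤ ∑ a ∈ s, B (w a) (w a) := by
  refine le_trans (Finset.sum_le_sum fun i hi => ?_) ((h.mono hs).sum_le hB hw rfl)
  exact (h.spectralValue_eq hj hB ((Finset.mem_range.1 hi).trans_le hs)).le

theorem mul_norm_sq_le_of_forall_unit {j : W →ₗ[ℝ] H} (hj : Function.Injective j)
    {B : W →ₗ[ℝ] W →ₗ[ℝ] ℝ} {s : Finset κ} {e : κ → W} {c : ℝ}
    (h : ∀ z, OrthTo j s e z → ‖j z‖ = 1 → c ≤ B z z) {v : W} (hv : OrthTo j s e v) :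
    c * ‖j v‖ ^ 2 ≤ B v v := by
  rcases eq_or_ne (j v) 0 with hv0 | hv0
  · rw [(map_eq_zero_iff j hj).1 hv0]; simp
  have hn0 : ‖j v‖ ≠ 0 := norm_ne_zero_iff.2 hv0
  have hz := h (‖j v‖⁻¹ • v) (fun a ha => by rw [map_smul, inner_smul_right, hv a ha, mul_zero])
    (by rw [map_smul, norm_smul, norm_inv, norm_norm, inv_mul_cancel₀ hn0])
  simp only [map_smul, LinearMap.smul_apply, smul_eq_mul] at hz
  calc c * ‖j v‖ ^ 2 ≤ (‖j v‖⁻¹ * (‖j v‖⁻¹ * B v v)) * ‖j v‖ ^ 2 := by gcongr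
    _ = B v v := by field_simp

/-- An orthonormal system on which the form takes the values of the eigenvalues consists of
eigenvectors. -/
theorem isEigenvector_of_form_eq_spectralValue {j : W →ₗ[ℝ] H} (hj : Function.Injective j)
    {B : W →ₗ[ℝ] W →ₗ[ℝ] ℝ} (hB : ∀ u v, B u v = B v u) {J : ℕ} {u : ℕ → W}
    (h : IsMinimizingSystem j B J u) {w : ℕ → W} (hw : OrthonormalFor j (Finset.range J) w)
    (hval : ∀ i < J, B (w i) (w i) = spectralValue j B (i + 1)) {i : ℕ} (hi : i < J) :
    IsEigenvector j B (spectralValue j B (i + 1)) (w i) := by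
  induction i using Nat.strong_induction_on with
  | _ i ih =>
    have hwi : OrthonormalFor j (Finset.range i) w :=
      hw.mono (Finset.range_subset_range.2 hi.le)
    rw [← hval i hi]
    refine IsConstrainedMinimizer.isEigenvector hB hwi
      (fun a ha => ⟨_, ih a (Finset.mem_range.1 ha) ((Finset.mem_range.1 ha).trans hi)⟩)
      ⟨hw.1 i (Finset.mem_range.2 hi), fun a ha => hw.2 a ?_ i (Finset.mem_range.2 hi) ?_, ?_⟩
    · exact Finset.mem_range.2 ((Finset.mem_range.1 ha).trans hi)
    · exact (Finset.mem_range.1 ha).ne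
    intro v hv
    refine mul_norm_sq_le_of_forall_unit hj (fun z hzo hz1 => ?_) hv
    -- Replace `w i` by the competitor `z` and apply Ky Fan to the resulting `i + 1` vectors; the
    -- first `i` values are the eigenvalues and cancel.
    have hne : ∀ a ∈ Finset.range i, Function.update w i z a = w a := fun a ha =>
      Function.update_of_ne (Finset.mem_range.1 ha).ne _ _
    have hor : OrthonormalFor j (Finset.range (i + 1)) (Function.update w i z) := by
      have hcase : ∀ a ∈ Finset.range (i + 1), a = i ∨ a ∈ Finset.range i := fun a ha => by
        rw [Finset.mem_range] at *; omega
      refine ⟨fun a ha => ?_, fun a ha b hb hab => ?_⟩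
      · rcases hcase a ha with rfl | ha'
        · rwa [Function.update_self]
        · rw [hne a ha']; exact hwi.1 a ha'
      · rcases hcase a ha with rfl | ha' <;> rcases hcase b hb with rfl | hb'
        · exact absurd rfl hab
        · rw [hne b hb', Function.update_self, real_inner_comm]; exact hzo b hb'
        · rw [hne a ha', Function.update_self]; exact hzo a ha'
        · rw [hne a ha', hne b hb']; exact hwi.2 a ha' b hb' hab
    have hKF := sum_spectralValue_le hj hB h hor (by rw [Finset.card_range]; exact hi)
    have hsum : ∑ a ∈ Finset.range i, B (Function.update w i z a) (Function.update w i z a) =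
        ∑ a ∈ Finset.range i, spectralValue j B (a + 1) :=
      Finset.sum_congr rfl fun a ha => by
        rw [hne a ha, hval a ((Finset.mem_range.1 ha).trans hi)]
    rw [Finset.card_range, Finset.sum_range_succ, Finset.sum_range_succ, Function.update_self,
      hsum, add_le_add_iff_left, ← hval i hi] at hKF
    exact hKF

end FormOnVectorSpace

/-! ### Weak limits in Hilbert spaces along filters and ultrafilters. -/

section WeakLimits

variable {H : Type*} [NormedAddCommGroup H] [InnerProductSpace ℝ H] {β : Type*}

/-- Weak convergence of a family along a filter. -/
def WeakLimit (F : Filter β) (x : β → H) (x₀ : H) : Prop :=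
  ∀ f : H, Tendsto (fun b => inner ℝ f (x b)) F (𝓝 (inner ℝ f x₀))

/-- Banach–Alaoglu, transported by the Riesz isomorphism. -/
theorem exists_weakLimit [CompleteSpace H] (F : Ultrafilter β) {x : β → H} {C : ℝ}
    (hx : ∀ᶠ b in F, ‖x b‖ ≤ C) : ∃ x₀, WeakLimit (F : Filter β) x x₀ := by
  let y : β → WeakDual ℝ H := fun b => StrongDual.toWeakDual (InnerProductSpace.toDual ℝ H (x b))
  have hK := WeakDual.isCompact_closedBall (𝕜 := ℝ) (E := H) 0 C
  obtain ⟨φ, -, hφ⟩ := hK.ultrafilter_le_nhds (F.map y) (by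
    rw [le_principal_iff, Ultrafilter.coe_map, mem_map]
    filter_upwards [hx] with b hb
    simpa [y] using hb)
  refine ⟨(InnerProductSpace.toDual ℝ H).symm (WeakDual.toStrongDual φ), fun f => ?_⟩
  have h1 : Tendsto y F (𝓝 φ) := hφ
  have h2 := ((WeakDual.eval_continuous f).tendsto φ).comp h1
  rw [real_inner_comm, InnerProductSpace.toDual_symm_apply]
  refine h2.congr fun b => ?_
  rw [real_inner_comm]
  rfl

theorem WeakLimit.dual [CompleteSpace H] {F : Filter β} {x : β → H} {x₀ : H}
    (h : WeakLimit F x x₀) (g : H →L[ℝ] ℝ) : Tendsto (fun b => g (x b)) F (𝓝 (g x₀)) := by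
  simpa using h ((InnerProductSpace.toDual ℝ H).symm g)

theorem WeakLimit.inner_tendsto {F : Filter β} {x y : β → H} {x₀ y₀ : H} {C : ℝ}
    (h : WeakLimit F x x₀) (hx : ∀ᶠ b in F, ‖x b‖ ≤ C) (hy : Tendsto y F (𝓝 y₀)) :
    Tendsto (fun b => inner ℝ (y b) (x b)) F (𝓝 (inner ℝ y₀ x₀)) := by
  have h0 : Tendsto (fun b => ‖y b - y₀‖ * C) F (𝓝 0) := by
    simpa using (tendsto_iff_norm_sub_tendsto_zero.1 hy).mul_const C
  have h1 : Tendsto (fun b => inner ℝ (y b - y₀) (x b)) F (𝓝 0) := by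
    refine squeeze_zero_norm' ?_ h0
    filter_upwards [hx] with b hb
    exact (norm_inner_le_norm _ _).trans (mul_le_mul_of_nonneg_left hb (norm_nonneg _))
  simpa [inner_sub_left] using h1.add (h y₀)

/-- Mazur's theorem: a point outside is strictly separated from `S` by a continuous functional,
which passes to the weak limit. -/
theorem WeakLimit.mem_of_convex [CompleteSpace H] {F : Filter β} [F.NeBot] {x : β → H} {x₀ : H}
    (h : WeakLimit F x x₀) {S : Set H} (hS : Convex ℝ S) (hSc : IsClosed S)
    (hx : ∀ᶠ b in F, x b ∈ S) : x₀ ∈ S := by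
  by_contra hx₀
  obtain ⟨g, t, hgt, htS⟩ := geometric_hahn_banach_point_closed hS hSc hx₀
  refine absurd (ge_of_tendsto (h.dual g) ?_) (not_le.2 hgt)
  filter_upwards [hx] with b hb using (htS _ hb).le

/-- Compactness provides some strong limit along the ultrafilter; testing against vectors identifies
it with `T x₀`. -/
theorem WeakLimit.tendsto_of_isCompactOperator [CompleteSpace H] {H' : Type*}
    [NormedAddCommGroup H'] [InnerProductSpace ℝ H'] {F : Ultrafilter β} {x : β → H} {x₀ : H}
    {C : ℝ} (h : WeakLimit (F : Filter β) x x₀) (hx : ∀ᶠ b in F, ‖x b‖ ≤ C) {T : H →L[ℝ] H'}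
    (hT : IsCompactOperator T) : Tendsto (fun b => T (x b)) F (𝓝 (T x₀)) := by
  have hcl := hT.isCompact_closure_image_closedBall (f := (T : H →ₗ[ℝ] H')) C
  obtain ⟨y, -, hy⟩ := hcl.ultrafilter_le_nhds
    (F.map fun b => T (x b)) (by
      rw [le_principal_iff, Ultrafilter.coe_map, mem_map]
      filter_upwards [hx] with b hb
      exact subset_closure ⟨x b, by simpa using hb, rfl⟩)
  have hy' : Tendsto (fun b => T (x b)) F (𝓝 y) := hy
  have : y = T x₀ := by
    refine ext_inner_left ℝ fun f => ?_
    exact tendsto_nhds_unique (tendsto_const_nhds.inner hy')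
      (h.dual ((innerSL ℝ f).comp T))
  rwa [← this]

theorem exists_bound_of_weakLimit [CompleteSpace H] {x : ℕ → H} {x₀ : H}
    (h : WeakLimit atTop x x₀) : ∃ C, ∀ n, ‖x n‖ ≤ C := by
  obtain ⟨C, hC⟩ := banach_steinhaus (g := fun n => innerSL ℝ (x n)) fun f => by
    obtain ⟨C, hC⟩ := (Metric.isBounded_range_of_tendsto _ (h f)).exists_norm_le
    exact ⟨C, fun n => by
      rw [innerSL_apply_apply, real_inner_comm]; exact hC _ (mem_range_self n)⟩
  exact ⟨C, fun n => by simpa using hC n⟩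

theorem exists_tendsto_of_bounded (F : Ultrafilter β) {a : β → ℝ} {s t : ℝ}
    (h : ∀ᶠ b in F, a b ∈ Icc s t) : ∃ l, Tendsto a F (𝓝 l) := by
  obtain ⟨l, -, hl⟩ := (isCompact_Icc (a := s) (b := t)).ultrafilter_le_nhds (F.map a)
    (by rw [le_principal_iff]; exact h)
  exact ⟨l, hl⟩

end WeakLimits

/-! ### Integrals of a potential against a square: lower semicontinuity, and duality through `L⁴`.
-/

section Integrals

variable {D : Type*} [MeasurableSpace D] {m : Measure D} {β : Type*}

theorem inner_eq_integral (f g : Lp ℝ 2 m) : inner ℝ f g = ∫ x, f x * g x ∂m := by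
  rw [L2.inner_def]
  exact integral_congr_ae (.of_forall fun x => mul_comm _ _)

theorem integrable_mul_L2 (f g : Lp ℝ 2 m) : Integrable (fun x => f x * g x) m :=
  (L2.integrable_inner (𝕜 := ℝ) g f)

theorem norm_sq_eq_integral (f : Lp ℝ 2 m) : ‖f‖ ^ 2 = ∫ x, f x ^ 2 ∂m := by
  rw [← real_inner_self_eq_norm_sq, inner_eq_integral]
  simp only [sq]

theorem integrable_sq_L2 (f : Lp ℝ 2 m) : Integrable (fun x => f x ^ 2) m := by
  simpa only [sq] using integrable_mul_L2 f f

/-- Truncation at the levels `-R` and `R`. -/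
noncomputable def clamp (R a : ℝ) : ℝ := max (-R) (min a R)

theorem abs_clamp_le {R : ℝ} (hR : 0 ≤ R) (a : ℝ) : |clamp R a| ≤ R :=
  abs_le.2 ⟨le_max_left _ _, max_le (by linarith) (min_le_right _ _)⟩

theorem clamp_eq_self {R a : ℝ} (h : |a| ≤ R) : clamp R a = a := by
  rw [clamp, min_eq_left (abs_le.1 h).2, max_eq_right (abs_le.1 h).1]

theorem clamp_sq_le {R : ℝ} (hR : 0 ≤ R) (a : ℝ) : clamp R a ^ 2 ≤ a ^ 2 := by
  rcases le_total |a| R with h | h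
  · rw [clamp_eq_self h]
  · exact sq_le_sq.2 ((abs_clamp_le hR a).trans h)

theorem lipschitzWith_clamp_sq (n : ℕ) : LipschitzWith (2 * n) fun a => clamp n a ^ 2 := by
  refine LipschitzWith.of_dist_le_mul fun a b => ?_
  have h1 : |clamp n a - clamp n b| ≤ |a - b| := by
    have := ((LipschitzWith.id.min_const (n : ℝ)).const_max (-(n : ℝ))).dist_le_mul a b
    simpa [Real.dist_eq, clamp] using this
  have h2 := abs_clamp_le (Nat.cast_nonneg n) a
  have h3 := abs_clamp_le (Nat.cast_nonneg n) b
  rw [Real.dist_eq, Real.dist_eq, sq_sub_sq, abs_mul]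
  push_cast
  refine mul_le_mul ((abs_add_le _ _).trans (by linarith)) h1 (abs_nonneg _) (by positivity)

theorem clamp_sq_zero (n : ℕ) : (fun a => clamp n a ^ 2) 0 = 0 := by
  simp [clamp_eq_self (R := (n : ℝ)) (a := 0) (by simp)]

/-- Lower semicontinuity of `(W, f) ↦ ∫ W f²`, `W ≥ 0`, for weak convergence of `W` and strong
convergence of `f`. -/
theorem integral_mul_sq_le_of_weakLimit_of_nonneg {F : Filter β} [F.NeBot] {W : β → Lp ℝ 2 m}
    {W₀ : Lp ℝ 2 m} {f : β → Lp ℝ 2 m} {f₀ : Lp ℝ 2 m} {C e : ℝ}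
    (hW : ∀ b, ∀ᵐ x ∂m, 0 ≤ W b x) (hW₀ : ∀ᵐ x ∂m, 0 ≤ W₀ x) (hlim : WeakLimit F W W₀)
    (hbdd : ∀ᶠ b in F, ‖W b‖ ≤ C) (hf : Tendsto f F (𝓝 f₀))
    (hint : ∀ b, Integrable (fun x => W b x * f b x ^ 2) m)
    (he : Tendsto (fun b => ∫ x, W b x * f b x ^ 2 ∂m) F (𝓝 e)) :
    Integrable (fun x => W₀ x * f₀ x ^ 2) m ∧ ∫ x, W₀ x * f₀ x ^ 2 ∂m ≤ e := by
  -- The truncated square is Lipschitz, so it acts continuously from `L²` to `L²` and can be paired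
  -- with a weakly convergent potential; the untruncated square need not be in `L²`.
  let φ : ℕ → Lp ℝ 2 m → Lp ℝ 2 m := fun n => (lipschitzWith_clamp_sq n).compLp (clamp_sq_zero n)
  have hφ : ∀ n g, φ n g =ᵐ[m] fun x => clamp n (g x) ^ 2 := fun n g =>
    (lipschitzWith_clamp_sq n).coeFn_compLp (clamp_sq_zero n) g
  have hprod : ∀ n (V g : Lp ℝ 2 m), (fun x => φ n g x * V x) =ᵐ[m]
      fun x => V x * clamp n (g x) ^ 2 := fun n V g => by
    filter_upwards [hφ n g] with x hx
    rw [hx, mul_comm]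
  have hle : ∀ n : ℕ, ∫ x, W₀ x * clamp n (f₀ x) ^ 2 ∂m ≤ e := by
    intro n
    have h1 := hlim.inner_tendsto hbdd
      ((((lipschitzWith_clamp_sq n).continuous_compLp (clamp_sq_zero n)).tendsto f₀).comp hf)
    have h2 : inner ℝ (φ n f₀) W₀ ≤ e := by
      refine le_of_tendsto_of_tendsto h1 he (.of_forall fun b => ?_)
      change inner ℝ (φ n (f b)) (W b) ≤ _
      rw [inner_eq_integral]
      refine integral_mono_ae (integrable_mul_L2 _ _) (hint b) ?_
      filter_upwards [hprod n (W b) (f b), hW b] with x hx h0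
      rw [hx]
      exact mul_le_mul_of_nonneg_left (clamp_sq_le (Nat.cast_nonneg n) _) h0
    rwa [inner_eq_integral, integral_congr_ae (hprod n W₀ f₀)] at h2
  have hcint : ∀ n : ℕ, Integrable (fun x => W₀ x * clamp n (f₀ x) ^ 2) m := fun n =>
    (integrable_congr (hprod n W₀ f₀)).1 (integrable_mul_L2 _ _)
  have hmeas : AEStronglyMeasurable (fun x => W₀ x * f₀ x ^ 2) m :=
    (Lp.aestronglyMeasurable W₀).mul ((Lp.aestronglyMeasurable f₀).pow 2)
  have hnn : 0 ≤ᵐ[m] fun x => W₀ x * f₀ x ^ 2 := by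
    filter_upwards [hW₀] with x hx using mul_nonneg hx (sq_nonneg _)
  have hnnc : ∀ n : ℕ, 0 ≤ᵐ[m] fun x => W₀ x * clamp n (f₀ x) ^ 2 := fun n => by
    filter_upwards [hW₀] with x hx using mul_nonneg hx (sq_nonneg _)
  -- Fatou's lemma removes the truncation: at each point it is eventually inactive.
  have hfatou : ∫⁻ x, ENNReal.ofReal (W₀ x * f₀ x ^ 2) ∂m ≤ ENNReal.ofReal e := by
    have hpt : ∀ x, liminf (fun n : ℕ => ENNReal.ofReal (W₀ x * clamp n (f₀ x) ^ 2)) atTop =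
        ENNReal.ofReal (W₀ x * f₀ x ^ 2) := by
      intro x
      refine Tendsto.liminf_eq (tendsto_const_nhds.congr' ?_)
      filter_upwards [eventually_ge_atTop ⌈|f₀ x|⌉₊] with n hn
      rw [clamp_eq_self (Nat.ceil_le.1 hn)]
    calc ∫⁻ x, ENNReal.ofReal (W₀ x * f₀ x ^ 2) ∂m
        = ∫⁻ x, liminf (fun n : ℕ => ENNReal.ofReal (W₀ x * clamp n (f₀ x) ^ 2)) atTop ∂m := by
          simp only [hpt]
      _ ≤ liminf (fun n : ℕ => ∫⁻ x, ENNReal.ofReal (W₀ x * clamp n (f₀ x) ^ 2) ∂m) atTop :=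
          lintegral_liminf_le' fun n => (hcint n).aestronglyMeasurable.aemeasurable.ennreal_ofReal
      _ ≤ liminf (fun _ : ℕ => ENNReal.ofReal e) atTop := by
          refine liminf_le_liminf (.of_forall fun n => ?_)
          rw [← ofReal_integral_eq_lintegral_ofReal (hcint n) (hnnc n)]
          exact ENNReal.ofReal_le_ofReal (hle n)
      _ = ENNReal.ofReal e := liminf_const _
  have hi : Integrable (fun x => W₀ x * f₀ x ^ 2) m :=
    ⟨hmeas, (hasFiniteIntegral_iff_ofReal hnn).2 (hfatou.trans_lt ENNReal.ofReal_lt_top)⟩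
  refine ⟨hi, ?_⟩
  have he0 : 0 ≤ e := (integral_nonneg_of_ae (hnnc 0)).trans (hle 0)
  rw [← ofReal_integral_eq_lintegral_ofReal hi hnn] at hfatou
  exact (ENNReal.ofReal_le_ofReal_iff he0).1 hfatou

/-- Subtracting the constant `Vmin`, which is in `L²` because the measure is finite, reduces to
nonnegative potentials; the correction `Vmin ‖f‖²` converges by strong convergence. -/
theorem integral_mul_sq_le_of_weakLimit [IsFiniteMeasure m] {F : Filter β} [F.NeBot]
    {V : β → Lp ℝ 2 m} {V₀ : Lp ℝ 2 m} {f : β → Lp ℝ 2 m} {f₀ : Lp ℝ 2 m} {C e Vmin : ℝ}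
    (hV : ∀ b, ∀ᵐ x ∂m, Vmin ≤ V b x) (hV₀ : ∀ᵐ x ∂m, Vmin ≤ V₀ x) (hlim : WeakLimit F V V₀)
    (hbdd : ∀ᶠ b in F, ‖V b‖ ≤ C) (hf : Tendsto f F (𝓝 f₀))
    (hint : ∀ b, Integrable (fun x => V b x * f b x ^ 2) m)
    (he : Tendsto (fun b => ∫ x, V b x * f b x ^ 2 ∂m) F (𝓝 e)) :
    Integrable (fun x => V₀ x * f₀ x ^ 2) m ∧ ∫ x, V₀ x * f₀ x ^ 2 ∂m ≤ e := by
  set c : Lp ℝ 2 m := Lp.const 2 m Vmin with hc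
  have hsub : ∀ g : Lp ℝ 2 m, ∀ᵐ x ∂m, (g - c) x = g x - Vmin := fun g => by
    filter_upwards [Lp.coeFn_sub g c, Lp.coeFn_const 2 m Vmin] with x hx hx'
    rw [hx, Pi.sub_apply, hc, hx', Function.const_apply]
  have hmul : ∀ g h : Lp ℝ 2 m, (fun x => (g - c) x * h x ^ 2) =ᵐ[m]
      fun x => g x * h x ^ 2 - Vmin * h x ^ 2 := fun g h => by
    filter_upwards [hsub g] with x hx
    rw [hx, sub_mul]
  have hcint : ∀ h : Lp ℝ 2 m, Integrable (fun x => Vmin * h x ^ 2) m := fun h =>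
    (integrable_sq_L2 h).const_mul _
  have hnn : ∀ g : Lp ℝ 2 m, (∀ᵐ x ∂m, Vmin ≤ g x) → ∀ᵐ x ∂m, 0 ≤ (g - c) x := fun g hg => by
    filter_upwards [hsub g, hg] with x hx hx'
    rw [hx]; linarith
  have hval : ∀ g h : Lp ℝ 2 m, Integrable (fun x => g x * h x ^ 2) m →
      ∫ x, (g - c) x * h x ^ 2 ∂m = ∫ x, g x * h x ^ 2 ∂m - Vmin * ‖h‖ ^ 2 := fun g h hi => by
    rw [integral_congr_ae (hmul g h), integral_sub hi (hcint h), integral_const_mul,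
      norm_sq_eq_integral]
  obtain ⟨h1, h2⟩ := integral_mul_sq_le_of_weakLimit_of_nonneg (W := fun b => V b - c)
    (W₀ := V₀ - c) (F := F) (f := f) (f₀ := f₀) (C := C + ‖c‖) (e := e - Vmin * ‖f₀‖ ^ 2)
    (fun b => hnn _ (hV b)) (hnn _ hV₀)
    (fun g => by simpa only [inner_sub_right] using (hlim g).sub_const _)
    (by filter_upwards [hbdd] with b hb
        exact (norm_sub_le _ _).trans (by linarith)) hf
    (fun b => (integrable_congr (hmul _ _)).2 ((hint b).sub (hcint _)))
    (by simp only [hval _ _ (hint _)]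
        exact he.sub ((hf.norm.pow 2).const_mul _))
  have h3 : Integrable (fun x => V₀ x * f₀ x ^ 2) m := by
    have := ((integrable_congr (hmul _ _)).1 h1).add (hcint f₀)
    refine this.congr (.of_forall fun x => ?_)
    simp
  refine ⟨h3, ?_⟩
  rw [hval _ _ h3] at h2
  linarith

/-- Hölder's exponents for the product of two functions in `L⁴`. -/
instance holderTriple_four_four_two : ENNReal.HolderTriple 4 4 2 where
  inv_add_inv_eq_inv := by
    rw [← two_mul, show (4 : ℝ≥0∞) = 2 * 2 by norm_num,
      ENNReal.mul_inv (Or.inl two_ne_zero) (Or.inl ENNReal.ofNat_ne_top), ← mul_assoc,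
      ENNReal.mul_inv_cancel two_ne_zero ENNReal.ofNat_ne_top, one_mul]

/-- The square of a function in `L⁴`, as an element of `L²`. -/
noncomputable def sqL4 (f : Lp ℝ 4 m) : Lp ℝ 2 m :=
  (ContinuousLinearMap.mul ℝ ℝ).holderL m 4 4 2 f f

theorem continuous_sqL4 : Continuous (sqL4 (m := m)) := by
  unfold sqL4
  fun_prop

theorem coeFn_sqL4 (f : Lp ℝ 4 m) : sqL4 f =ᵐ[m] fun x => f x ^ 2 := by
  filter_upwards [(ContinuousLinearMap.mul ℝ ℝ).coeFn_holder (r := 2) f f] with x hx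
  rw [sq]
  exact hx

/-- For a function in `L⁴`, the potential energy is thus a bounded linear functional of `V`,
continuous for weak convergence. -/
theorem inner_sqL4 (V : Lp ℝ 2 m) {f : Lp ℝ 4 m} {g : Lp ℝ 2 m} (h : f =ᵐ[m] g) :
    inner ℝ (sqL4 f) V = ∫ x, V x * g x ^ 2 ∂m := by
  rw [inner_eq_integral]
  refine integral_congr_ae ?_
  filter_upwards [coeFn_sqL4 f, h] with x hx hx'
  rw [hx, hx', mul_comm]

theorem integrable_mul_sq_of_memLp (V : Lp ℝ 2 m) {g : Lp ℝ 2 m} (h : MemLp g 4 m) :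
    Integrable (fun x => V x * g x ^ 2) m := by
  refine (integrable_mul_L2 (sqL4 h.toLp) V).congr ?_
  filter_upwards [coeFn_sqL4 h.toLp, h.coeFn_toLp] with x hx hx'
  rw [hx, hx', mul_comm]

theorem exists_bound_sqL4 {S : Set (Lp ℝ 4 m)} (hS : IsCompact S) :
    ∃ N : ℝ≥0, ∀ f ∈ S, ‖sqL4 f‖ ≤ N := by
  obtain ⟨N, hN⟩ := (hS.image continuous_sqL4).isBounded.exists_norm_le
  exact ⟨N.toNNReal, fun f hf => (hN _ (mem_image_of_mem _ hf)).trans (Real.le_coe_toNNReal N)⟩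

end Integrals

/-! ### Spectral theory of `ℰ_V` for a fixed potential bounded below. -/

section SinglePotential

variable {D : Type*} [MeasurableSpace D] {m : Measure D}
  {𝕍 : Type*} [NormedAddCommGroup 𝕍] [InnerProductSpace ℝ 𝕍] {β : Type*}

/-- A coercive symmetric form on a Hilbert space compactly embedded in `L²`. -/
structure CoerciveForm (ι : 𝕍 →L[ℝ] Lp ℝ 2 m) (E : 𝕍 →L[ℝ] 𝕍 →L[ℝ] ℝ) (M : ℝ) : Prop where
  injective : Function.Injective ι
  compact : IsCompactOperator ι
  symm : ∀ u v, E u v = E v u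
  pos : 0 < M
  nonneg : ∀ u, 0 ≤ E u u
  coercive : ∀ u, M⁻¹ * ‖u‖ ^ 2 ≤ E u u + ‖ι u‖ ^ 2

/-- The potential `V` is bounded below by `Vmin`. -/
def BoundedBelow (Vmin : ℝ) (V : Lp ℝ 2 m) : Prop := ∀ᵐ x ∂m, Vmin ≤ V x

/-- The energy `ℰ(u) + ∫ V u² dm`. -/
noncomputable def energy (ι : 𝕍 →L[ℝ] Lp ℝ 2 m) (E : 𝕍 →L[ℝ] 𝕍 →L[ℝ] ℝ) (V : Lp ℝ 2 m)
    (u : 𝕍) : ℝ :=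
  E u u + ∫ x, V x * (ι u x) ^ 2 ∂m

theorem partialEnergy_eq_sum_energy (ι : 𝕍 →L[ℝ] Lp ℝ 2 m) (E : 𝕍 →L[ℝ] 𝕍 →L[ℝ] ℝ) {J : ℕ}
    (k : ℕ) (V : Lp ℝ 2 m) (w : Fin J → 𝕍) :
    partialEnergy ι E k V w =
      ∑ i ∈ Finset.univ.filter (fun i : Fin J => i.val < k), energy ι E V (w i) := rfl

variable {ι : 𝕍 →L[ℝ] Lp ℝ 2 m} {E : 𝕍 →L[ℝ] 𝕍 →L[ℝ] ℝ} {M Vmin : ℝ} {V : Lp ℝ 2 m}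

theorem mem_formDomain_of_integrable {u : 𝕍} (h : Integrable (fun x => V x * (ι u x) ^ 2) m) :
    u ∈ formDomain ι V := by
  refine h.mono ((Lp.aestronglyMeasurable V).sup aestronglyMeasurable_const |>.mul
    ((Lp.aestronglyMeasurable (ι u)).pow 2)) (.of_forall fun x => ?_)
  rw [norm_mul, norm_mul]
  refine mul_le_mul_of_nonneg_right ?_ (norm_nonneg _)
  rw [Real.norm_eq_abs, Real.norm_eq_abs, abs_of_nonneg (le_max_right _ _)]
  exact max_le (le_abs_self _) (abs_nonneg _)

/-- This makes the eigenfunctions of one potential admissible competitors for all the others. -/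
theorem mem_formDomain_of_memLp {u : 𝕍} (V : Lp ℝ 2 m) (h : MemLp (ι u) 4 m) :
    u ∈ formDomain ι V :=
  mem_formDomain_of_integrable (integrable_mul_sq_of_memLp V h)

theorem BoundedBelow.integrable_sq (hV : BoundedBelow Vmin V) {u : 𝕍} (hu : u ∈ formDomain ι V) :
    Integrable (fun x => V x * (ι u x) ^ 2) m := by
  have hu' : Integrable (fun x => max (V x) 0 * (ι u x) ^ 2) m := hu
  refine (hu'.add ((integrable_sq_L2 (ι u)).const_mul |Vmin|)).mono'
    ((Lp.aestronglyMeasurable V).mul ((Lp.aestronglyMeasurable (ι u)).pow 2)) ?_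
  filter_upwards [hV] with x hx
  rw [norm_mul, Real.norm_eq_abs, Real.norm_of_nonneg (sq_nonneg _), Pi.add_apply, ← add_mul]
  refine mul_le_mul_of_nonneg_right (abs_le.2 ⟨?_, ?_⟩) (sq_nonneg _)
  · linarith [neg_abs_le Vmin, le_max_right (V x) 0]
  · linarith [abs_nonneg Vmin, le_max_left (V x) 0]

theorem BoundedBelow.integrable_mul (hV : BoundedBelow Vmin V) {u v : 𝕍}
    (hu : u ∈ formDomain ι V) (hv : v ∈ formDomain ι V) :
    Integrable (fun x => V x * ι u x * ι v x) m := by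
  refine ((hV.integrable_sq hu).abs.add (hV.integrable_sq hv).abs).mono'
    (((Lp.aestronglyMeasurable V).mul (Lp.aestronglyMeasurable (ι u))).mul
      (Lp.aestronglyMeasurable (ι v))) (.of_forall fun x => ?_)
  simp only [norm_mul, Real.norm_eq_abs, Pi.add_apply, abs_mul, abs_pow]
  nlinarith [abs_nonneg (V x), mul_nonneg (abs_nonneg (V x)) (sq_nonneg (|ι u x| - |ι v x|)),
    mul_nonneg (abs_nonneg (V x)) (sq_nonneg (ι u x)), sq_abs (ι u x), sq_abs (ι v x),
    mul_nonneg (abs_nonneg (V x)) (sq_nonneg (|ι u x| + |ι v x|))]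

theorem BoundedBelow.le_integral (hV : BoundedBelow Vmin V) {u : 𝕍} (hu : u ∈ formDomain ι V) :
    Vmin * ‖ι u‖ ^ 2 ≤ ∫ x, V x * (ι u x) ^ 2 ∂m := by
  rw [norm_sq_eq_integral, ← integral_const_mul]
  refine integral_mono_ae ((integrable_sq_L2 _).const_mul _) (hV.integrable_sq hu) ?_
  filter_upwards [hV] with x hx using mul_le_mul_of_nonneg_right hx (sq_nonneg _)

/-- The embedding of the form domain in `L²`. -/
noncomputable def formEmbedding (ι : 𝕍 →L[ℝ] Lp ℝ 2 m) (V : Lp ℝ 2 m) :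
    formDomain ι V →ₗ[ℝ] Lp ℝ 2 m :=
  (ι : 𝕍 →ₗ[ℝ] Lp ℝ 2 m).comp (formDomain ι V).subtype

@[simp]
theorem formEmbedding_apply (u : formDomain ι V) : formEmbedding ι V u = ι u := rfl

/-- The bilinear form `ℰ_V` on its domain. -/
noncomputable def BoundedBelow.form (hV : BoundedBelow Vmin V) (ι : 𝕍 →L[ℝ] Lp ℝ 2 m)
    (E : 𝕍 →L[ℝ] 𝕍 →L[ℝ] ℝ) : formDomain ι V →ₗ[ℝ] formDomain ι V →ₗ[ℝ] ℝ :=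
  LinearMap.mk₂ ℝ (fun u v => E u v + ∫ x, V x * ι u x * ι v x ∂m)
    (fun u u' v => by
      have h : (fun x => V x * ι ((u + u' : formDomain ι V) : 𝕍) x * ι v x) =ᵐ[m]
          fun x => V x * ι u x * ι v x + V x * ι u' x * ι v x := by
        rw [Submodule.coe_add, map_add]
        filter_upwards [Lp.coeFn_add (ι u) (ι u')] with x hx
        rw [hx, Pi.add_apply]; ring
      rw [integral_congr_ae h, integral_add (hV.integrable_mul u.2 v.2)
        (hV.integrable_mul u'.2 v.2), Submodule.coe_add, map_add, _root_.add_apply]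
      ring)
    (fun c u v => by
      have h : (fun x => V x * ι ((c • u : formDomain ι V) : 𝕍) x * ι v x) =ᵐ[m]
          fun x => c * (V x * ι u x * ι v x) := by
        rw [Submodule.coe_smul, map_smul]
        filter_upwards [Lp.coeFn_smul c (ι u)] with x hx
        rw [hx, Pi.smul_apply, smul_eq_mul]; ring
      rw [integral_congr_ae h, integral_const_mul, Submodule.coe_smul, map_smul,
        _root_.smul_apply, smul_eq_mul, smul_eq_mul]
      ring)
    (fun u v v' => by
      have h : (fun x => V x * ι u x * ι ((v + v' : formDomain ι V) : 𝕍) x) =ᵐ[m]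
          fun x => V x * ι u x * ι v x + V x * ι u x * ι v' x := by
        rw [Submodule.coe_add, map_add]
        filter_upwards [Lp.coeFn_add (ι v) (ι v')] with x hx
        rw [hx, Pi.add_apply]; ring
      rw [integral_congr_ae h, integral_add (hV.integrable_mul u.2 v.2)
        (hV.integrable_mul u.2 v'.2), Submodule.coe_add, map_add]
      ring)
    (fun c u v => by
      have h : (fun x => V x * ι u x * ι ((c • v : formDomain ι V) : 𝕍) x) =ᵐ[m]
          fun x => c * (V x * ι u x * ι v x) := by
        rw [Submodule.coe_smul, map_smul]
        filter_upwards [Lp.coeFn_smul c (ι v)] with x hx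
        rw [hx, Pi.smul_apply, smul_eq_mul]; ring
      rw [integral_congr_ae h, integral_const_mul, Submodule.coe_smul, map_smul, smul_eq_mul,
        smul_eq_mul]
      ring)

theorem BoundedBelow.form_apply (hV : BoundedBelow Vmin V) (u v : formDomain ι V) :
    hV.form ι E u v = E u v + ∫ x, V x * ι u x * ι v x ∂m := rfl

theorem BoundedBelow.form_self (hV : BoundedBelow Vmin V) (u : formDomain ι V) :
    hV.form ι E u u = energy ι E V u := by
  simp only [hV.form_apply, energy, sq, mul_assoc]

theorem CoerciveForm.form_symm (C : CoerciveForm ι E M) (hV : BoundedBelow Vmin V)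
    (u v : formDomain ι V) : hV.form ι E u v = hV.form ι E v u := by
  rw [hV.form_apply, hV.form_apply, C.symm]
  simp only [mul_right_comm]

theorem CoerciveForm.formEmbedding_injective (C : CoerciveForm ι E M) (V : Lp ℝ 2 m) :
    Function.Injective (formEmbedding ι V) :=
  C.injective.comp Subtype.val_injective

theorem BoundedBelow.isEigenfunction_iff (hV : BoundedBelow Vmin V) {lam : ℝ} {u : 𝕍} :
    IsEigenfunction ι E V lam u ↔
      ∃ h : u ∈ formDomain ι V,
        IsEigenvector (formEmbedding ι V) (hV.form ι E) lam ⟨u, h⟩ := by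
  constructor
  · rintro ⟨h, h0, hv⟩
    refine ⟨h, fun h' => h0 (congrArg Subtype.val h'), fun v => ?_⟩
    rw [inner_eq_integral]
    exact hv v v.2
  · rintro ⟨h, h0, hv⟩
    refine ⟨h, fun h' => h0 (Subtype.ext h'), fun v hv' => ?_⟩
    have := hv ⟨v, hv'⟩
    rw [inner_eq_integral] at this
    exact this

theorem BoundedBelow.eigenvalue_eq (hV : BoundedBelow Vmin V) (k : ℕ) :
    eigenvalue ι E k V = spectralValue (formEmbedding ι V) (hV.form ι E) k := by
  rw [eigenvalue, spectralValue]
  congr 1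
  ext t
  constructor
  · rintro ⟨u, hu, hut⟩
    choose μ hμt hμ using hut
    refine ⟨fun i => ⟨u i, (hμ i).1⟩, LinearIndependent.of_comp (formDomain ι V).subtype hu,
      fun i => ⟨μ i, hμt i, (hV.isEigenfunction_iff.1 (hμ i)).2⟩⟩
  · rintro ⟨u, hu, hut⟩
    refine ⟨fun i => u i, hu.map' (formDomain ι V).subtype (Submodule.ker_subtype _), fun i => ?_⟩
    obtain ⟨μ, hμt, hμ⟩ := hut i
    exact ⟨μ, hμt, hV.isEigenfunction_iff.2 ⟨(u i).2, hμ⟩⟩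

theorem CoerciveForm.le_energy (C : CoerciveForm ι E M) (hV : BoundedBelow Vmin V) {u : 𝕍}
    (hu : u ∈ formDomain ι V) (hu1 : ‖ι u‖ = 1) : Vmin ≤ energy ι E V u := by
  have := hV.le_integral hu
  rw [hu1] at this
  rw [energy]
  linarith [C.nonneg u]

/-- Compactness of families with bounded energies, and lower semicontinuity of the energy. -/
theorem CoerciveForm.exists_weakLimit_energy_le [IsFiniteMeasure m] [CompleteSpace 𝕍]
    (C : CoerciveForm ι E M)
    {F : Ultrafilter β} {W : β → Lp ℝ 2 m} {c e : ℝ} (hW : ∀ b, BoundedBelow Vmin (W b))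
    (hV : BoundedBelow Vmin V) (hlim : WeakLimit (F : Filter β) W V)
    (hbdd : ∀ᶠ b in F, ‖W b‖ ≤ c) {u : β → 𝕍} (hu : ∀ b, u b ∈ formDomain ι (W b))
    (hu1 : ∀ b, ‖ι (u b)‖ = 1) (he : Tendsto (fun b => energy ι E (W b) (u b)) F (𝓝 e)) :
    ∃ u₀, WeakLimit (F : Filter β) u u₀ ∧ Tendsto (fun b => ι (u b)) F (𝓝 (ι u₀)) ∧
      u₀ ∈ formDomain ι V ∧ energy ι E V u₀ ≤ e := by
  have hE : ∀ᶠ b in F, E (u b) (u b) ∈ Icc 0 (e + 1 - Vmin) := by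
    filter_upwards [he.eventually_lt_const (lt_add_one e)] with b hb
    have := (hW b).le_integral (hu b)
    rw [hu1] at this
    rw [energy] at hb
    exact ⟨C.nonneg _, by linarith⟩
  -- Coercivity bounds `‖u b‖²`; the inequality `‖u‖ ≤ 1 + ‖u‖²` avoids a square root.
  have hub : ∀ᶠ b in F, ‖u b‖ ≤ 1 + M * (e + 1 - Vmin + 1) := by
    filter_upwards [hE] with b hb
    have h1 := C.coercive (u b)
    rw [hu1, inv_mul_le_iff₀ C.pos] at h1
    have h2 : ‖u b‖ ^ 2 ≤ M * (e + 1 - Vmin + 1) :=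
      h1.trans (mul_le_mul_of_nonneg_left (by linarith [hb.2]) C.pos.le)
    nlinarith [sq_nonneg (‖u b‖ - 1)]
  obtain ⟨u₀, hu₀⟩ := exists_weakLimit F hub
  have hstrong := hu₀.tendsto_of_isCompactOperator hub C.compact
  -- Along the ultrafilter `ℰ(u b)` has a limit `a`, so the potential part tends to `e - a` and the
  -- two parts can be treated separately.
  obtain ⟨a, ha⟩ := exists_tendsto_of_bounded F hE
  have hEle : E u₀ u₀ ≤ a := by
    have h1 := ((hu₀.dual (E u₀)).const_mul 2).sub_const (E u₀ u₀)
    have h2 : 2 * E u₀ u₀ - E u₀ u₀ ≤ a := by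
      refine le_of_tendsto_of_tendsto h1 ha (.of_forall fun b => ?_)
      -- Weak lower semicontinuity of `ℰ`, by expanding `ℰ(u b - u₀) ≥ 0`.
      have := C.nonneg (u b - u₀)
      simp only [map_sub, _root_.sub_apply] at this
      rw [C.symm (u b) u₀] at this
      linarith
    linarith
  obtain ⟨h1, h2⟩ := integral_mul_sq_le_of_weakLimit hW hV hlim hbdd hstrong
    (fun b => (hW b).integrable_sq (hu b)) (e := e - a) (by
      refine (he.sub ha).congr fun b => ?_
      rw [energy]; ring)
  exact ⟨u₀, hu₀, hstrong, mem_formDomain_of_integrable h1, by rw [energy]; linarith⟩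

/-- The direct method: a minimizing sequence for the constant family of potentials `V`. The norm and
orthogonality constraints survive because convergence in `L²` is strong. -/
theorem CoerciveForm.hasMinimizers [IsFiniteMeasure m] [CompleteSpace 𝕍] (C : CoerciveForm ι E M)
    (hV : BoundedBelow Vmin V) : HasMinimizers (formEmbedding ι V) (hV.form ι E) := by
  rintro n e ⟨u, hu0, hu⟩
  set A : Set ℝ := {t | ∃ v : formDomain ι V, ‖formEmbedding ι V v‖ = 1 ∧
    OrthTo (formEmbedding ι V) (Finset.range n) e v ∧ hV.form ι E v v = t} with hA
  have hAne : A.Nonempty := by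
    have hn0 : ‖formEmbedding ι V u‖ ≠ 0 := by
      rw [norm_ne_zero_iff]
      exact (map_ne_zero_iff _ (C.formEmbedding_injective V)).2 hu0
    refine ⟨_, ‖formEmbedding ι V u‖⁻¹ • u, ?_, fun a ha => ?_, rfl⟩
    · rw [map_smul, norm_smul, norm_inv, norm_norm, inv_mul_cancel₀ hn0]
    · rw [map_smul, inner_smul_right, hu a ha, mul_zero]
  have hAb : BddBelow A := by
    refine ⟨Vmin, ?_⟩
    rintro _ ⟨v, hv1, -, rfl⟩
    rw [hV.form_self]
    exact C.le_energy hV v.2 hv1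
  obtain ⟨t, -, ht, htA⟩ := exists_seq_tendsto_sInf hAne hAb
  choose v hv1 hvo hvt using htA
  have he : Tendsto (fun n => energy ι E V (v n : 𝕍)) (hyperfilter ℕ : Filter ℕ) (𝓝 (sInf A)) := by
    refine (ht.mono_left Nat.hyperfilter_le_atTop).congr fun n => ?_
    rw [← hvt, hV.form_self]
  obtain ⟨u₀, -, hs, hmem, hle⟩ := C.exists_weakLimit_energy_le (F := hyperfilter ℕ)
    (W := fun _ => V) (fun _ => hV) hV (fun f => tendsto_const_nhds) (.of_forall fun _ => le_rfl)
    (fun n => (v n).2) hv1 he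
  refine ⟨⟨u₀, hmem⟩, ?_, fun a ha => ?_, fun w hw => ?_⟩
  · refine tendsto_nhds_unique hs.norm (tendsto_const_nhds.congr fun n => ?_)
    exact (hv1 n).symm
  · refine tendsto_nhds_unique (tendsto_const_nhds.inner hs) (tendsto_const_nhds.congr fun n => ?_)
    exact (hvo n a ha).symm
  · refine mul_norm_sq_le_of_forall_unit (C.formEmbedding_injective V) (fun z hz hz1 => ?_) hw
    rw [hV.form_self]
    exact hle.trans (csInf_le hAb ⟨z, hz1, hz, rfl⟩)

/-- The system `w` is orthonormal in `L²`. -/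
def IsOrthonormalSystem (ι : 𝕍 →L[ℝ] Lp ℝ 2 m) {J : ℕ} (w : Fin J → 𝕍) : Prop :=
  (∀ i, ‖ι (w i)‖ = 1) ∧ ∀ i l, i ≠ l → inner ℝ (ι (w i)) (ι (w l)) = (0 : ℝ)

variable {J : ℕ}

theorem isOrthonormalSystem_of_mem_eigenSystems {w : Fin J → 𝕍}
    (hw : w ∈ eigenSystems ι E J V) : IsOrthonormalSystem ι w :=
  ⟨fun i => (hw.1 i).2, fun i l hil => by rw [inner_eq_integral]; exact hw.2 i l hil⟩

theorem eigenvalueSum_eq_sum_range (k : ℕ) (V : Lp ℝ 2 m) :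
    eigenvalueSum ι E k V = ∑ i ∈ Finset.range k, eigenvalue ι E (i + 1) V := by
  rw [eigenvalueSum, Finset.range_eq_Ico, Finset.sum_Ico_add' (fun i => eigenvalue ι E i V)]
  rfl

theorem sum_filter_lt_eq_sum_range {k : ℕ} (hk : k ≤ J) (f : ℕ → ℝ) :
    ∑ i ∈ Finset.univ.filter (fun i : Fin J => i.val < k), f i = ∑ i ∈ Finset.range k, f i := by
  rw [Finset.sum_filter, Fin.sum_univ_eq_sum_range (fun i => if i < k then f i else 0),
    ← Finset.sum_filter]
  refine Finset.sum_congr ?_ fun _ _ => rfl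
  ext i
  simp only [Finset.mem_filter, Finset.mem_range]
  omega

theorem CoerciveForm.exists_isMinimizingSystem [IsFiniteMeasure m] [CompleteSpace 𝕍]
    (C : CoerciveForm ι E M) (hV : BoundedBelow Vmin V)
    (hJ : (J : Cardinal) ≤ Module.rank ℝ (formDomain ι V)) :
    ∃ u, IsMinimizingSystem (formEmbedding ι V) (hV.form ι E) J u :=
  (C.hasMinimizers hV).exists_isMinimizingSystem hJ

theorem CoerciveForm.eigenSystems_nonempty [IsFiniteMeasure m] [CompleteSpace 𝕍]
    (C : CoerciveForm ι E M) (hV : BoundedBelow Vmin V)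
    (hJ : (J : Cardinal) ≤ Module.rank ℝ (formDomain ι V)) :
    (eigenSystems ι E J V).Nonempty := by
  obtain ⟨u, hu⟩ := C.exists_isMinimizingSystem hV hJ
  have hB := C.form_symm hV
  refine ⟨fun i => u i, fun i => ⟨?_, (hu i i.2).1⟩, fun i l hil => ?_⟩
  · rw [hV.eigenvalue_eq, hu.spectralValue_eq (C.formEmbedding_injective V) hB i.2]
    exact hV.isEigenfunction_iff.2 ⟨_, hu.isEigenvector hB i.2⟩
  · rw [← inner_eq_integral]
    exact hu.orthonormalFor.2 i (Finset.mem_range.2 i.2) l (Finset.mem_range.2 l.2)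
      fun h => hil (Fin.ext h)

/-- Ky Fan's inequality for the form `ℰ_V`. -/
theorem CoerciveForm.eigenvalueSum_le [IsFiniteMeasure m] [CompleteSpace 𝕍]
    (C : CoerciveForm ι E M) (hV : BoundedBelow Vmin V)
    (hJ : (J : Cardinal) ≤ Module.rank ℝ (formDomain ι V)) {k : ℕ} (hk : k ≤ J) {w : Fin J → 𝕍}
    (hw : IsOrthonormalSystem ι w) (hwV : ∀ i, w i ∈ formDomain ι V) :
    eigenvalueSum ι E k V ≤ partialEnergy ι E k V w := by
  obtain ⟨u, hu⟩ := C.exists_isMinimizingSystem hV hJ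
  have hcard : (Finset.univ.filter (fun i : Fin J => i.val < k)).card = k := by
    have := sum_filter_lt_eq_sum_range hk fun _ => 1
    simpa using this
  have h := sum_spectralValue_le (C.formEmbedding_injective V) (C.form_symm hV) hu
    (s := Finset.univ.filter (fun i : Fin J => i.val < k)) (w := fun i => ⟨w i, hwV i⟩)
    ⟨fun a _ => hw.1 a, fun a _ b _ => hw.2 a b⟩ (by rw [hcard]; exact hk)
  rw [hcard] at h
  simp only [hV.form_self] at h
  rw [eigenvalueSum_eq_sum_range, partialEnergy_eq_sum_energy]
  simp only [hV.eigenvalue_eq]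
  exact h

theorem BoundedBelow.energy_eq (hV : BoundedBelow Vmin V) {u : 𝕍} {lam : ℝ}
    (hu : IsEigenfunction ι E V lam u) (hu1 : ‖ι u‖ = 1) : energy ι E V u = lam := by
  obtain ⟨h, hu'⟩ := hV.isEigenfunction_iff.1 hu
  have := hu'.2 ⟨u, h⟩
  rw [hV.form_self, formEmbedding_apply, real_inner_self_eq_norm_sq, hu1] at this
  simpa using this

theorem BoundedBelow.partialEnergy_eq (hV : BoundedBelow Vmin V) {k : ℕ} (hk : k ≤ J)
    {w : Fin J → 𝕍} (hw : w ∈ eigenSystems ι E J V) :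
    partialEnergy ι E k V w = eigenvalueSum ι E k V := by
  rw [eigenvalueSum_eq_sum_range, ← sum_filter_lt_eq_sum_range hk, partialEnergy_eq_sum_energy]
  exact Finset.sum_congr rfl fun i _ => hV.energy_eq (hw.1 i).1 (hw.1 i).2

theorem CoerciveForm.mem_eigenSystems [IsFiniteMeasure m] [CompleteSpace 𝕍]
    (C : CoerciveForm ι E M) (hV : BoundedBelow Vmin V)
    (hJ : (J : Cardinal) ≤ Module.rank ℝ (formDomain ι V)) {w : Fin J → 𝕍}
    (hw : IsOrthonormalSystem ι w) (hwV : ∀ i, w i ∈ formDomain ι V)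
    (hval : ∀ i, energy ι E V (w i) = eigenvalue ι E (i.val + 1) V) :
    w ∈ eigenSystems ι E J V := by
  obtain ⟨u, hu⟩ := C.exists_isMinimizingSystem hV hJ
  -- The value `0` beyond `J` is only padding to obtain a family indexed by `ℕ`.
  let z : ℕ → formDomain ι V := fun i => if h : i < J then ⟨w ⟨i, h⟩, hwV _⟩ else 0
  have hz : ∀ i (h : i < J), z i = ⟨w ⟨i, h⟩, hwV _⟩ := fun i h => dif_pos h
  have hzo : OrthonormalFor (formEmbedding ι V) (Finset.range J) z := by
    refine ⟨fun a ha => ?_, fun a ha b hb hab => ?_⟩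
    · rw [hz a (Finset.mem_range.1 ha)]; exact hw.1 _
    · rw [hz a (Finset.mem_range.1 ha), hz b (Finset.mem_range.1 hb)]
      exact hw.2 _ _ fun h => hab (congrArg Fin.val h)
  refine ⟨fun i => ⟨?_, hw.1 i⟩, fun i l hil => ?_⟩
  · have := isEigenvector_of_form_eq_spectralValue (C.formEmbedding_injective V)
      (C.form_symm hV) hu hzo (fun i hi => by
        rw [hV.form_self, ← hV.eigenvalue_eq, hz i hi]; exact hval ⟨i, hi⟩) i.2
    rw [hz i i.2] at this
    rw [hV.eigenvalue_eq]
    exact hV.isEigenfunction_iff.2 ⟨_, this⟩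
  · rw [← inner_eq_integral]; exact hw.2 i l hil

end SinglePotential

/-! ### Dependence on the potential: weak continuity, concavity, Lipschitz bounds and compactness.
-/

section FamilyOfPotentials

variable {D : Type*} [MeasurableSpace D] {m : Measure D}
  {𝕍 : Type*} [NormedAddCommGroup 𝕍] [InnerProductSpace ℝ 𝕍] {β : Type*}

/-- `V` is bounded below, its eigenfunctions are in `L⁴`, and its form domain has dimension at
least `J`. -/
structure IsAdmissible (ι : 𝕍 →L[ℝ] Lp ℝ 2 m) (E : 𝕍 →L[ℝ] 𝕍 →L[ℝ] ℝ) (J : ℕ) (Vmin : ℝ)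
    (V : Lp ℝ 2 m) : Prop where
  boundedBelow : BoundedBelow Vmin V
  memLp : ∀ (lam : ℝ) (u : 𝕍), IsEigenfunction ι E V lam u → MemLp (ι u) 4 m
  rank : (J : Cardinal) ≤ Module.rank ℝ (formDomain ι V)

variable {ι : 𝕍 →L[ℝ] Lp ℝ 2 m} {E : 𝕍 →L[ℝ] 𝕍 →L[ℝ] ℝ} {M Vmin : ℝ} {V : Lp ℝ 2 m} {J : ℕ}

theorem IsAdmissible.memLp_of_mem (hV : IsAdmissible ι E J Vmin V) {w : Fin J → 𝕍}
    (hw : w ∈ eigenSystems ι E J V) (i : Fin J) : MemLp (ι (w i)) 4 m :=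
  hV.memLp _ _ (hw.1 i).1

theorem exists_L4_representatives {w : Fin J → 𝕍} (hw : ∀ i, MemLp (ι (w i)) 4 m) :
    ∃ q : Fin J → Lp ℝ 4 m, ∀ i, q i =ᵐ[m] ι (w i) :=
  ⟨fun i => (hw i).toLp, fun i => (hw i).coeFn_toLp⟩

/-- The energies of a system in `L⁴` depend on the potential in an affine way. -/
theorem partialEnergy_eq_add_inner {w : Fin J → 𝕍} {q : Fin J → Lp ℝ 4 m}
    (hq : ∀ i, q i =ᵐ[m] ι (w i)) (k : ℕ) (V : Lp ℝ 2 m) :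
    partialEnergy ι E k V w =
      ∑ i ∈ Finset.univ.filter (fun i : Fin J => i.val < k), E (w i) (w i) +
        inner ℝ (∑ i ∈ Finset.univ.filter (fun i : Fin J => i.val < k), sqL4 (q i)) V := by
  rw [sum_inner, ← Finset.sum_add_distrib]
  exact Finset.sum_congr rfl fun i _ => by rw [inner_sqL4 V (hq i)]

theorem partialEnergy_le_add {w : Fin J → 𝕍} {q : Fin J → Lp ℝ 4 m}
    (hq : ∀ i, q i =ᵐ[m] ι (w i)) {N : ℝ} (hN : ∀ i, ‖sqL4 (q i)‖ ≤ N) (k : ℕ)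
    (V V' : Lp ℝ 2 m) :
    partialEnergy ι E k V' w ≤ partialEnergy ι E k V w + J * N * ‖V' - V‖ := by
  rw [partialEnergy_eq_add_inner hq, partialEnergy_eq_add_inner hq, add_assoc]
  gcongr
  rw [← sub_le_iff_le_add', ← inner_sub_right]
  refine (real_inner_le_norm _ _).trans (mul_le_mul_of_nonneg_right ?_ (norm_nonneg _))
  calc ‖∑ i ∈ Finset.univ.filter (fun i : Fin J => i.val < k), sqL4 (q i)‖
      ≤ ∑ i ∈ Finset.univ.filter (fun i : Fin J => i.val < k), ‖sqL4 (q i)‖ := norm_sum_le _ _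
    _ ≤ ∑ i : Fin J, ‖sqL4 (q i)‖ :=
        Finset.sum_le_sum_of_subset_of_nonneg (Finset.filter_subset _ _)
          fun _ _ _ => norm_nonneg _
    _ ≤ ∑ _i : Fin J, N := Finset.sum_le_sum fun i _ => hN i
    _ = J * N := by simp

theorem partialEnergy_combo {w : Fin J → 𝕍} (hw : ∀ i, MemLp (ι (w i)) 4 m) (k : ℕ)
    (V V' : Lp ℝ 2 m) {a b : ℝ} (hab : a + b = 1) :
    partialEnergy ι E k (a • V + b • V') w =
      a * partialEnergy ι E k V w + b * partialEnergy ι E k V' w := by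
  obtain ⟨q, hq⟩ := exists_L4_representatives hw
  simp only [partialEnergy_eq_add_inner hq, inner_add_right, inner_smul_right]
  linear_combination
    -(∑ i ∈ Finset.univ.filter (fun i : Fin J => i.val < k), E (w i) (w i)) * hab

theorem CoerciveForm.le_eigenvalue (C : CoerciveForm ι E M) (hV : BoundedBelow Vmin V)
    {w : Fin J → 𝕍} (hw : w ∈ eigenSystems ι E J V) (i : Fin J) :
    Vmin ≤ eigenvalue ι E (i.val + 1) V := by
  rw [← hV.energy_eq (hw.1 i).1 (hw.1 i).2]
  exact C.le_energy hV (hw.1 i).1.1 (hw.1 i).2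

theorem eigenvalueSum_eq_sum_univ (V : Lp ℝ 2 m) :
    eigenvalueSum ι E J V = ∑ i : Fin J, eigenvalue ι E (i.val + 1) V := by
  rw [eigenvalueSum_eq_sum_range, Fin.sum_univ_eq_sum_range fun i => eigenvalue ι E (i + 1) V]

/-- The other `J - 1` eigenvalues are at least `Vmin`, so a bound on the sum bounds each term. -/
theorem CoerciveForm.eigenvalue_le (C : CoerciveForm ι E M) (hV : BoundedBelow Vmin V)
    {w : Fin J → 𝕍} (hw : w ∈ eigenSystems ι E J V) (i : Fin J) :
    eigenvalue ι E (i.val + 1) V ≤ eigenvalueSum ι E J V - J * Vmin + Vmin := by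
  have := Finset.single_le_sum (f := fun l : Fin J => eigenvalue ι E (l.val + 1) V - Vmin)
    (fun l _ => sub_nonneg.2 (C.le_eigenvalue hV hw l)) (Finset.mem_univ i)
  rw [Finset.sum_sub_distrib, ← eigenvalueSum_eq_sum_univ] at this
  simp only [Finset.sum_const, Finset.card_univ, Fintype.card_fin, nsmul_eq_mul] at this
  linarith

theorem sum_filter_lt_succ (f : Fin J → ℝ) (i : Fin J) :
    ∑ l ∈ Finset.univ.filter (fun l : Fin J => l.val < i.val + 1), f l =
      f i + ∑ l ∈ Finset.univ.filter (fun l : Fin J => l.val < i.val), f l := by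
  rw [← Finset.sum_insert (by simp)]
  refine Finset.sum_congr ?_ fun _ _ => rfl
  ext l
  simp only [Finset.mem_filter, Finset.mem_univ, true_and, Finset.mem_insert, Fin.ext_iff]
  omega

/-- Weak convergence and convergence of `ℰ` give `ℰ(u - u₀) → 0` by expansion; coercivity turns this
into convergence in norm. -/
theorem CoerciveForm.tendsto_of_weakLimit [CompleteSpace 𝕍] (C : CoerciveForm ι E M)
    {F : Filter β} {u : β → 𝕍}
    {u₀ : 𝕍} (hu : WeakLimit F u u₀) (hι : Tendsto (fun b => ι (u b)) F (𝓝 (ι u₀)))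
    (hE : Tendsto (fun b => E (u b) (u b)) F (𝓝 (E u₀ u₀))) : Tendsto u F (𝓝 u₀) := by
  rw [tendsto_iff_norm_sub_tendsto_zero]
  have h1 : Tendsto (fun b => E (u b) (u b) - 2 * E u₀ (u b) + E u₀ u₀) F (𝓝 0) := by
    have := (hE.sub ((hu.dual (E u₀)).const_mul 2)).add_const (E u₀ u₀)
    convert this using 2
    ring
  have h2 : Tendsto (fun b => ‖ι (u b) - ι u₀‖ ^ 2) F (𝓝 0) := by
    simpa using (tendsto_iff_norm_sub_tendsto_zero.1 hι).pow 2
  have h3 : Tendsto (fun b => ‖u b - u₀‖ ^ 2) F (𝓝 0) := by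
    refine squeeze_zero (fun b => sq_nonneg _) (fun b => ?_)
      (by simpa using (h1.add h2).const_mul M)
    have := C.coercive (u b - u₀)
    rw [inv_mul_le_iff₀ C.pos] at this
    refine this.trans (le_of_eq ?_)
    simp only [map_sub, _root_.sub_apply]
    rw [C.symm (u b) u₀]
    ring
  simpa using h3.sqrt

/-- The systems of eigenfunctions of potentials in `K`, with their classes in `L⁴`. -/
def eigenSystemsL4 (ι : 𝕍 →L[ℝ] Lp ℝ 2 m) (E : 𝕍 →L[ℝ] 𝕍 →L[ℝ] ℝ) (J : ℕ)
    (K : Set (Lp ℝ 2 m)) : Set (Fin J → 𝕍 × Lp ℝ 4 m) :=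
  {p | (fun i => (p i).1) ∈ ⋃ V ∈ K, eigenSystems ι E J V ∧
    ∀ i, ((p i).2 : D → ℝ) =ᵐ[m] ι (p i).1}

theorem isLeast_partialEnergy {K : Set (Lp ℝ 2 m)} (hK : ∀ V ∈ K, IsAdmissible ι E J Vmin V)
    (hcomp : IsCompact (eigenSystemsL4 ι E J K)) (hne : (⋃ V ∈ K, eigenSystems ι E J V).Nonempty)
    (k : ℕ) (V : Lp ℝ 2 m) :
    IsLeast (partialEnergy ι E k V '' ⋃ V ∈ K, eigenSystems ι E J V)
      (sInf (partialEnergy ι E k V '' ⋃ V ∈ K, eigenSystems ι E J V)) := by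
  have himg : partialEnergy ι E k V '' (⋃ V ∈ K, eigenSystems ι E J V) =
      (fun p : Fin J → 𝕍 × Lp ℝ 4 m => partialEnergy ι E k V fun i => (p i).1) ''
        eigenSystemsL4 ι E J K := by
    ext t
    constructor
    · rintro ⟨w, hw, rfl⟩
      obtain ⟨V', hV', hw'⟩ := mem_iUnion₂.1 hw
      obtain ⟨q, hq⟩ := exists_L4_representatives fun i => (hK _ hV').memLp_of_mem hw' i
      exact ⟨fun i => (w i, q i), ⟨hw, hq⟩, rfl⟩
    · rintro ⟨p, hp, rfl⟩
      exact ⟨_, hp.1, rfl⟩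
  refine IsCompact.isLeast_sInf ?_ (hne.image _)
  rw [himg]
  refine hcomp.image_of_continuousOn (ContinuousOn.congr (f := fun p : Fin J → 𝕍 × Lp ℝ 4 m =>
    ∑ i ∈ Finset.univ.filter (fun i : Fin J => i.val < k), E (p i).1 (p i).1 +
      inner ℝ (∑ i ∈ Finset.univ.filter (fun i : Fin J => i.val < k), sqL4 (p i).2) V) ?_
    fun p hp => partialEnergy_eq_add_inner hp.2 k V)
  have := continuous_sqL4 (m := m)
  fun_prop

variable [IsFiniteMeasure m] [CompleteSpace 𝕍]

/-- Eigenvalues pass to the limit along weakly convergent potentials, and systems of eigenfunctions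
have limits that are systems of eigenfunctions. -/
theorem CoerciveForm.exists_limit_eigenSystem (C : CoerciveForm ι E M) {F : Ultrafilter β}
    {W : β → Lp ℝ 2 m} {c : ℝ} (hW : ∀ b, IsAdmissible ι E J Vmin (W b))
    (hV : IsAdmissible ι E J Vmin V) (hlim : WeakLimit (F : Filter β) W V)
    (hbdd : ∀ᶠ b in F, ‖W b‖ ≤ c) {w : β → Fin J → 𝕍}
    (hw : ∀ b, w b ∈ eigenSystems ι E J (W b)) :
    ∃ w₀ ∈ eigenSystems ι E J V, ∀ i, WeakLimit (F : Filter β) (fun b => w b i) (w₀ i) ∧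
      Tendsto (fun b => ι (w b i)) F (𝓝 (ι (w₀ i))) ∧
      Tendsto (fun b => eigenvalue ι E (i.val + 1) (W b)) F
        (𝓝 (eigenvalue ι E (i.val + 1) V)) := by
  -- A system of the limit potential is the competitor for every `W b`; being in `L⁴`, its energies
  -- converge under weak convergence of the potentials.
  obtain ⟨v, hv⟩ := C.eigenSystems_nonempty hV.boundedBelow hV.rank
  obtain ⟨q, hq⟩ := exists_L4_representatives fun i => hV.memLp_of_mem hv i
  have hub : ∀ k ≤ J, ∀ b, eigenvalueSum ι E k (W b) ≤ partialEnergy ι E k (W b) v :=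
    fun k hk b => C.eigenvalueSum_le (hW b).boundedBelow (hW b).rank hk
      (isOrthonormalSystem_of_mem_eigenSystems hv)
      fun i => mem_formDomain_of_memLp _ (hV.memLp_of_mem hv i)
  have hublim : ∀ k ≤ J, Tendsto (fun b => partialEnergy ι E k (W b) v) F
      (𝓝 (eigenvalueSum ι E k V)) := fun k hk => by
    rw [← hV.boundedBelow.partialEnergy_eq hk hv]
    simp only [partialEnergy_eq_add_inner hq]
    exact (hlim _).const_add _
  have hex : ∀ i : Fin J, ∃ l, Tendsto (fun b => eigenvalue ι E (i.val + 1) (W b)) F (𝓝 l) := by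
    intro i
    refine exists_tendsto_of_bounded F (s := Vmin)
      (t := eigenvalueSum ι E J V + 1 - J * Vmin + Vmin) ?_
    filter_upwards [(hublim J le_rfl).eventually_lt_const (lt_add_one _)] with b hb
    refine ⟨C.le_eigenvalue (hW b).boundedBelow (hw b) i, ?_⟩
    have h1 := C.eigenvalue_le (hW b).boundedBelow (hw b) i
    have h2 := hub J le_rfl b
    linarith
  choose l hl using hex
  have hlimit := fun i : Fin J => C.exists_weakLimit_energy_le
    (fun b => (hW b).boundedBelow) hV.boundedBelow hlim hbdd (u := fun b => w b i)
    (fun b => ((hw b).1 i).1.1) (fun b => ((hw b).1 i).2) (e := l i)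
    ((hl i).congr fun b => ((hW b).boundedBelow.energy_eq ((hw b).1 i).1 ((hw b).1 i).2).symm)
  choose w₀ hweak hstrong hmem hle using hlimit
  have horth : IsOrthonormalSystem ι w₀ := by
    refine ⟨fun i => tendsto_nhds_unique (hstrong i).norm (tendsto_const_nhds.congr fun b =>
      ((hw b).1 i).2.symm), fun i j hij => tendsto_nhds_unique ((hstrong i).inner (hstrong j))
      (tendsto_const_nhds.congr fun b => ?_)⟩
    exact ((isOrthonormalSystem_of_mem_eigenSystems (hw b)).2 i j hij).symm
  -- The sandwich: `σ_k(V) ≤ ∑ energy(w₀) ≤ ∑ l ≤ σ_k(V)`, by Ky Fan at `V`, lower semicontinuity,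
  -- and Ky Fan at `W b` with competitor `v`.
  have hsum : ∀ k ≤ J,
      ∑ i ∈ Finset.univ.filter (fun i : Fin J => i.val < k), eigenvalue ι E (i.val + 1) V =
        ∑ i ∈ Finset.univ.filter (fun i : Fin J => i.val < k), energy ι E V (w₀ i) ∧
      ∑ i ∈ Finset.univ.filter (fun i : Fin J => i.val < k), eigenvalue ι E (i.val + 1) V =
        ∑ i ∈ Finset.univ.filter (fun i : Fin J => i.val < k), l i := by
    intro k hk
    have h1 := C.eigenvalueSum_le hV.boundedBelow hV.rank hk horth hmem
    rw [partialEnergy_eq_sum_energy, eigenvalueSum_eq_sum_range,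
      ← sum_filter_lt_eq_sum_range hk fun i => eigenvalue ι E (i + 1) V] at h1
    have h2 : ∑ i ∈ Finset.univ.filter (fun i : Fin J => i.val < k), energy ι E V (w₀ i) ≤
        ∑ i ∈ Finset.univ.filter (fun i : Fin J => i.val < k), l i :=
      Finset.sum_le_sum fun i _ => hle i
    have h3 : ∑ i ∈ Finset.univ.filter (fun i : Fin J => i.val < k), l i ≤
        eigenvalueSum ι E k V := by
      refine le_of_tendsto_of_tendsto (tendsto_finsetSum _ fun i _ => hl i) (hublim k hk)
        (.of_forall fun b => ?_)
      refine le_trans (le_of_eq ?_) (hub k hk b)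
      rw [eigenvalueSum_eq_sum_range,
        ← sum_filter_lt_eq_sum_range hk fun i => eigenvalue ι E (i + 1) (W b)]
    rw [eigenvalueSum_eq_sum_range,
      ← sum_filter_lt_eq_sum_range hk fun i => eigenvalue ι E (i + 1) V] at h3
    exact ⟨by linarith, by linarith⟩
  -- Subtract the equalities for `k = i` and `k = i + 1`.
  have hterm : ∀ i : Fin J, eigenvalue ι E (i.val + 1) V = energy ι E V (w₀ i) ∧
      eigenvalue ι E (i.val + 1) V = l i := by
    intro i
    have h1 := hsum i i.2.le
    have h2 := hsum (i + 1) i.2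
    simp only [sum_filter_lt_succ] at h2
    exact ⟨by linarith [h1.1, h2.1], by linarith [h1.2, h2.2]⟩
  refine ⟨w₀, C.mem_eigenSystems hV.boundedBelow hV.rank horth hmem fun i => (hterm i).1.symm,
    fun i => ⟨hweak i, hstrong i, ?_⟩⟩
  rw [(hterm i).2]
  exact hl i

theorem CoerciveForm.weaklyContinuousOn_eigenvalue (C : CoerciveForm ι E M) {K : Set (Lp ℝ 2 m)}
    (hK : ∀ V ∈ K, IsAdmissible ι E J Vmin V) {k : ℕ} (hk : 1 ≤ k) (hkJ : k ≤ J) :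
    WeaklyContinuousOn (eigenvalue ι E k) K := by
  intro Vn V hVn hV hlim
  obtain ⟨c, hc⟩ := exists_bound_of_weakLimit hlim
  choose w hw using fun n =>
    C.eigenSystems_nonempty (hK _ (hVn n)).boundedBelow (hK _ (hVn n)).rank
  rw [tendsto_iff_ultrafilter]
  intro F hF
  obtain ⟨w₀, -, h⟩ := C.exists_limit_eigenSystem (F := F) (fun n => hK _ (hVn n)) (hK _ hV)
    (fun f => (hlim f).mono_left hF) (.of_forall hc) hw
  have := (h ⟨k - 1, by omega⟩).2.2
  rwa [Nat.sub_add_cancel hk] at this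

theorem CoerciveForm.weaklyContinuousOn_eigenvalueSum (C : CoerciveForm ι E M)
    {K : Set (Lp ℝ 2 m)} (hK : ∀ V ∈ K, IsAdmissible ι E J Vmin V) {k : ℕ} (hkJ : k ≤ J) :
    WeaklyContinuousOn (eigenvalueSum ι E k) K := by
  intro Vn V hVn hV hlim
  refine tendsto_finsetSum _ fun h hh => ?_
  rw [Finset.mem_Icc] at hh
  exact C.weaklyContinuousOn_eigenvalue hK hh.1 (hh.2.trans hkJ) Vn V hVn hV hlim

/-- A system of eigenfunctions of an admissible potential is a competitor for any other one. -/
theorem CoerciveForm.eigenvalueSum_le_of_mem (C : CoerciveForm ι E M) {V' : Lp ℝ 2 m}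
    (hV : IsAdmissible ι E J Vmin V) (hV' : IsAdmissible ι E J Vmin V') {k : ℕ} (hk : k ≤ J)
    {w : Fin J → 𝕍} (hw : w ∈ eigenSystems ι E J V') :
    eigenvalueSum ι E k V ≤ partialEnergy ι E k V w :=
  C.eigenvalueSum_le hV.boundedBelow hV.rank hk (isOrthonormalSystem_of_mem_eigenSystems hw)
    fun i => mem_formDomain_of_memLp _ (hV'.memLp_of_mem hw i)

/-- A system of the convex combination is tested at both endpoints, and its energy is affine in the
potential. -/
theorem CoerciveForm.concaveOn_eigenvalueSum (C : CoerciveForm ι E M) {K : Set (Lp ℝ 2 m)}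
    (hK : ∀ V ∈ K, IsAdmissible ι E J Vmin V) (hconv : Convex ℝ K) {k : ℕ} (hk : k ≤ J) :
    ConcaveOn ℝ K (eigenvalueSum ι E k) := by
  refine ⟨hconv, fun V₁ h₁ V₂ h₂ a b ha hb hab => ?_⟩
  have h := hK _ (hconv h₁ h₂ ha hb hab)
  obtain ⟨w, hw⟩ := C.eigenSystems_nonempty h.boundedBelow h.rank
  rw [← h.boundedBelow.partialEnergy_eq hk hw, partialEnergy_combo (h.memLp_of_mem hw) k V₁ V₂ hab,
    smul_eq_mul, smul_eq_mul]
  exact add_le_add (mul_le_mul_of_nonneg_left (C.eigenvalueSum_le_of_mem (hK _ h₁) h hk hw) ha)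
    (mul_le_mul_of_nonneg_left (C.eigenvalueSum_le_of_mem (hK _ h₂) h hk hw) hb)

/-- The eigenfunctions of the potentials in a bounded set that belong to systems of `J` ones lie
in a compact subset of `L⁴`. -/
theorem CoerciveForm.exists_isCompact_L4 (C : CoerciveForm ι E M) {K : Set (Lp ℝ 2 m)}
    (hK : ∀ V ∈ K, IsAdmissible ι E J Vmin V) {c : ℝ} (hKc : ∀ V ∈ K, ‖V‖ ≤ c)
    {Λ₀ : ℝ} (hcomp : ∀ Λ > Λ₀, IsCompact (closure {f : Lp ℝ 4 m |
      ∃ u ∈ {u : 𝕍 | ‖ι u‖ = 1 ∧ ∃ V ∈ K, ∃ lam ≤ Λ, IsEigenfunction ι E V lam u},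
        (f : D → ℝ) =ᵐ[m] ι u})) :
    ∃ S : Set (Lp ℝ 4 m), IsCompact S ∧ ∀ V ∈ K, ∀ w ∈ eigenSystems ι E J V, ∀ (i : Fin J)
      (f : Lp ℝ 4 m), f =ᵐ[m] ι (w i) → f ∈ S := by
  rcases K.eq_empty_or_nonempty with rfl | ⟨V₀, hV₀⟩
  · exact ⟨∅, isCompact_empty, by simp⟩
  obtain ⟨v, hv⟩ := C.eigenSystems_nonempty (hK _ hV₀).boundedBelow (hK _ hV₀).rank
  obtain ⟨q, hq⟩ := exists_L4_representatives fun i => (hK _ hV₀).memLp_of_mem hv i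
  set Q := ∑ i ∈ Finset.univ.filter (fun i : Fin J => i.val < J), sqL4 (q i) with hQ
  set a := ∑ i ∈ Finset.univ.filter (fun i : Fin J => i.val < J), E (v i) (v i) with ha
  -- The first entry puts the level above `Λ₀`. The second bounds all `J` eigenvalues on `K`: the
  -- system `v` of `V₀` gives `σ_J(V) ≤ a + ‖Q‖ c`.
  refine ⟨_, hcomp (max (Λ₀ + 1) (a + ‖Q‖ * c - J * Vmin + Vmin))
    ((lt_add_one _).trans_le (le_max_left _ _)), fun V hV w hw i f hf => ?_⟩
  refine subset_closure ⟨w i, ⟨(hw.1 i).2, V, hV, _, le_max_of_le_right ?_, (hw.1 i).1⟩, hf⟩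
  have h1 := C.eigenvalue_le (hK V hV).boundedBelow hw i
  have h2 := C.eigenvalueSum_le_of_mem (hK V hV) (hK _ hV₀) le_rfl hv
  rw [partialEnergy_eq_add_inner hq, ← hQ, ← ha] at h2
  have h3 : inner ℝ Q V ≤ ‖Q‖ * c :=
    (real_inner_le_norm _ _).trans (mul_le_mul_of_nonneg_left (hKc V hV) (norm_nonneg _))
  linarith

theorem CoerciveForm.lipschitzOnWith_eigenvalueSum (C : CoerciveForm ι E M) {K : Set (Lp ℝ 2 m)}
    (hK : ∀ V ∈ K, IsAdmissible ι E J Vmin V) {S : Set (Lp ℝ 4 m)} (hS : IsCompact S)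
    (hKS : ∀ V ∈ K, ∀ w ∈ eigenSystems ι E J V, ∀ (i : Fin J)
      (f : Lp ℝ 4 m), f =ᵐ[m] ι (w i) → f ∈ S) {k : ℕ} (hk : k ≤ J) :
    ∃ L : ℝ≥0, LipschitzOnWith L (eigenvalueSum ι E k) K := by
  obtain ⟨N, hN⟩ := exists_bound_sqL4 hS
  -- The system of `V` is a competitor for `V'`, with slope a sum of at most `J` squares of `L²`
  -- norm at most `N`; the roles are symmetric.
  refine ⟨J * N, LipschitzOnWith.of_le_add_mul _ fun V' hV' V hV => ?_⟩
  obtain ⟨w, hw⟩ := C.eigenSystems_nonempty (hK _ hV).boundedBelow (hK _ hV).rank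
  obtain ⟨q, hq⟩ := exists_L4_representatives fun i => (hK _ hV).memLp_of_mem hw i
  have h := partialEnergy_le_add (E := E) hq
    (fun i => hN _ (hKS V hV w hw i _ (hq i))) k V V'
  rw [(hK V hV).boundedBelow.partialEnergy_eq hk hw] at h
  rw [dist_eq_norm]
  push_cast
  exact (C.eigenvalueSum_le_of_mem (hK _ hV') (hK _ hV) hk hw).trans h

theorem CoerciveForm.lipschitzOnWith_eigenvalue (C : CoerciveForm ι E M) {K : Set (Lp ℝ 2 m)}
    (hK : ∀ V ∈ K, IsAdmissible ι E J Vmin V) {S : Set (Lp ℝ 4 m)} (hS : IsCompact S)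
    (hKS : ∀ V ∈ K, ∀ w ∈ eigenSystems ι E J V, ∀ (i : Fin J)
      (f : Lp ℝ 4 m), f =ᵐ[m] ι (w i) → f ∈ S) {k : ℕ} (hk : 1 ≤ k) (hkJ : k ≤ J) :
    ∃ L : ℝ≥0, LipschitzOnWith L (eigenvalue ι E k) K := by
  obtain ⟨n, rfl⟩ := Nat.exists_eq_add_of_le' hk
  obtain ⟨L₁, h₁⟩ := C.lipschitzOnWith_eigenvalueSum hK hS hKS hkJ
  obtain ⟨L₂, h₂⟩ := C.lipschitzOnWith_eigenvalueSum hK hS hKS (Nat.le_of_succ_le hkJ)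
  refine ⟨L₁ + L₂, LipschitzOnWith.of_dist_le_mul fun V hV V' hV' => ?_⟩
  have heq : ∀ V, eigenvalue ι E (n + 1) V = eigenvalueSum ι E (n + 1) V - eigenvalueSum ι E n V :=
    fun V => by
      rw [eigenvalueSum_eq_sum_range, eigenvalueSum_eq_sum_range, Finset.sum_range_succ]; ring
  have h3 := h₁.dist_le_mul V hV V' hV'
  have h4 := h₂.dist_le_mul V hV V' hV'
  rw [heq, heq]
  push_cast
  exact (dist_sub_sub_le _ _ _ _).trans (by linarith)

/-- Convergence in `L⁴` implies convergence in `L²`, on a finite measure space. -/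
theorem tendsto_L2_of_tendsto_L4 {F : Filter β} {q : β → Lp ℝ 4 m} {q₀ : Lp ℝ 4 m}
    {f : β → Lp ℝ 2 m} (hq : Tendsto q F (𝓝 q₀)) (hf : ∀ b, q b =ᵐ[m] f b) :
    ∃ f₀ : Lp ℝ 2 m, q₀ =ᵐ[m] f₀ ∧ Tendsto f F (𝓝 f₀) := by
  have hmem : MemLp q₀ 2 m := (Lp.memLp q₀).mono_exponent (by norm_num)
  refine ⟨hmem.toLp, hmem.coeFn_toLp.symm, ?_⟩
  -- The squared `L²` norm is the pairing of the square with the constant `1`, which is in `L²` by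
  -- finiteness of the measure.
  have hsq : ∀ b, ‖f b - hmem.toLp‖ ^ 2 = inner ℝ (sqL4 (q b - q₀)) (Lp.const 2 m (1 : ℝ)) := by
    intro b
    rw [norm_sq_eq_integral, inner_eq_integral]
    refine integral_congr_ae ?_
    filter_upwards [Lp.coeFn_sub (f b) hmem.toLp, hmem.coeFn_toLp, hf b, coeFn_sqL4 (q b - q₀),
      Lp.coeFn_sub (q b) q₀, Lp.coeFn_const 2 m (1 : ℝ)] with x h1 h2 h3 h4 h5 h6
    rw [h1, h4, h5, h6, Pi.sub_apply, Pi.sub_apply, h2, h3, Function.const_apply, mul_one]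
  have h0 : Tendsto (fun b => ‖f b - hmem.toLp‖ ^ 2) F (𝓝 0) := by
    simp only [hsq]
    have h1 : Tendsto (fun b => sqL4 (q b - q₀)) F (𝓝 (sqL4 0)) :=
      (continuous_sqL4.tendsto 0).comp (tendsto_sub_nhds_zero_iff.2 hq)
    have h2 : sqL4 (0 : Lp ℝ 4 m) = 0 := by simp [sqL4]
    rw [h2] at h1
    simpa using h1.inner (tendsto_const_nhds (x := Lp.const 2 m (1 : ℝ)))
  rw [tendsto_iff_norm_sub_tendsto_zero]
  simpa using h0.sqrt

theorem CoerciveForm.isCompact_eigenSystemsL4 (C : CoerciveForm ι E M) {K : Set (Lp ℝ 2 m)}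
    (hK : ∀ V ∈ K, IsAdmissible ι E J Vmin V) {c : ℝ} (hKc : ∀ V ∈ K, ‖V‖ ≤ c)
    (hconv : Convex ℝ K) (hclosed : IsClosed K) {S : Set (Lp ℝ 4 m)} (hS : IsCompact S)
    (hKS : ∀ V ∈ K, ∀ w ∈ eigenSystems ι E J V, ∀ (i : Fin J)
      (f : Lp ℝ 4 m), f =ᵐ[m] ι (w i) → f ∈ S) :
    IsCompact (eigenSystemsL4 ι E J K) := by
  rw [isCompact_iff_ultrafilter_le_nhds]
  intro F hF
  rw [le_principal_iff] at hF
  obtain ⟨p', hp'⟩ := F.nonempty_of_mem hF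
  classical
  -- A modification of the identity with all its values in the set, so that a potential can be
  -- chosen for every index; it is eventually equal to the identity along `F`.
  let p : (Fin J → 𝕍 × Lp ℝ 4 m) → (Fin J → 𝕍 × Lp ℝ 4 m) :=
    fun b => if b ∈ eigenSystemsL4 ι E J K then b else p'
  have hp : ∀ b, p b ∈ eigenSystemsL4 ι E J K := fun b => by
    by_cases hb : b ∈ eigenSystemsL4 ι E J K
    · rwa [show p b = b from if_pos hb]
    · rwa [show p b = p' from if_neg hb]
  have hpF : p =ᶠ[(F : Filter _)] id := by
    filter_upwards [hF] with b hb using if_pos hb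
  suffices ∃ p₀ ∈ eigenSystemsL4 ι E J K, Tendsto p F (𝓝 p₀) by
    obtain ⟨p₀, hp₀, h⟩ := this
    exact ⟨p₀, hp₀, tendsto_id'.1 (h.congr' hpF)⟩
  have hex : ∀ b, ∃ V ∈ K, (fun i => (p b i).1) ∈ eigenSystems ι E J V := fun b => by
    simpa using (hp b).1
  choose W hW hw using hex
  have hbdd : ∀ᶠ b in F, ‖W b‖ ≤ c := .of_forall fun b => hKc _ (hW b)
  obtain ⟨V, hlim⟩ := exists_weakLimit F hbdd
  have hV : V ∈ K := hlim.mem_of_convex hconv hclosed (.of_forall hW)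
  obtain ⟨w₀, hw₀, hconvg⟩ := C.exists_limit_eigenSystem (fun b => hK _ (hW b)) (hK V hV) hlim
    hbdd hw
  have hL4 : ∀ i, ∃ q₀ : Lp ℝ 4 m, q₀ =ᵐ[m] ι (w₀ i) ∧
      Tendsto (fun b => (p b i).2) F (𝓝 q₀) := fun i => by
    obtain ⟨q₀, -, hq₀⟩ := hS.ultrafilter_le_nhds (F.map fun b => (p b i).2)
      (by rw [le_principal_iff]
          exact mem_map.2 <| univ_mem' fun b => hKS _ (hW b) _ (hw b) i _ ((hp b).2 i))
    replace hq₀ : Tendsto (fun b => (p b i).2) F (𝓝 q₀) := hq₀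
    obtain ⟨f₀, hf₀, hf⟩ := tendsto_L2_of_tendsto_L4 (F := (F : Filter _))
      (q := fun b => (p b i).2) hq₀ (fun b => (hp b).2 i)
    -- The `L⁴` limit and the weak limit in `𝕍` represent the same function, by uniqueness of the
    -- limit in `L²`.
    rw [tendsto_nhds_unique (hconvg i).2.1 hf]
    exact ⟨q₀, hf₀, hq₀⟩
  choose q₀ hq₀ hq using hL4
  -- Write `ℰ(u) = λ - ∫ V u²`: the eigenvalues converge, and the integral pairs weakly convergent
  -- potentials with strongly convergent squares.
  have hE : ∀ i, Tendsto (fun b => E (p b i).1 (p b i).1) F (𝓝 (E (w₀ i) (w₀ i))) := fun i => by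
    have h1 := hlim.inner_tendsto hbdd ((continuous_sqL4.tendsto _).comp (hq i))
    have h2 := (hconvg i).2.2.sub h1
    have h3 : eigenvalue ι E (i.val + 1) V - inner ℝ (sqL4 (q₀ i)) V = E (w₀ i) (w₀ i) := by
      rw [inner_sqL4 V (hq₀ i), ← (hK V hV).boundedBelow.energy_eq (hw₀.1 i).1 (hw₀.1 i).2, energy]
      ring
    rw [h3] at h2
    refine h2.congr fun b => ?_
    rw [Function.comp_apply, inner_sqL4 (W b) ((hp b).2 i),
      ← (hK _ (hW b)).boundedBelow.energy_eq ((hw b).1 i).1 ((hw b).1 i).2, energy]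
    ring
  refine ⟨fun i => (w₀ i, q₀ i), ⟨mem_iUnion₂.2 ⟨V, hV, hw₀⟩, hq₀⟩, tendsto_pi_nhds.2 fun i => ?_⟩
  exact (C.tendsto_of_weakLimit (hconvg i).1 (hconvg i).2.1 (hE i)).prodMk_nhds (hq i)

end FamilyOfPotentials

/-! ### Closedness and convexity of `𝕂[c]`. -/

section Potentials

variable {D : Type*} [MeasurableSpace D] {m : Measure D}

theorem penalized_le_iff {𝒦 : Lp ℝ 2 m → EReal} {θ c : ℝ} {V : Lp ℝ 2 m} :
    penalized 𝒦 θ V ≤ c ↔ 𝒦 V ≤ ((c - θ / 2 * ‖V‖ ^ 2 : ℝ) : EReal) := by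
  rw [penalized, EReal.coe_sub]
  exact (EReal.le_sub_iff_add_le (.inl (EReal.coe_ne_bot _)) (.inl (EReal.coe_ne_top _))).symm

/-- With the continuous quadratic term on the right-hand side, the second condition is a preimage of
the closed epigraph of `𝒦`. -/
theorem isClosed_boundedPotentials {𝒦 : Lp ℝ 2 m → EReal} (h : LowerSemicontinuous 𝒦)
    (θ c : ℝ) : IsClosed (boundedPotentials 𝒦 θ c) := by
  have heq : boundedPotentials 𝒦 θ c = {V | ‖V‖ ≤ c} ∩
      {V | 𝒦 V ≤ ((c - θ / 2 * ‖V‖ ^ 2 : ℝ) : EReal)} := by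
    ext V
    simp only [boundedPotentials, properDomain, mem_ofPred_eq, mem_inter_iff, penalized_le_iff]
    exact ⟨fun h => h.2, fun h => ⟨h.2.trans_lt (EReal.coe_lt_top _), h⟩⟩
  rw [heq]
  refine (isClosed_le continuous_norm continuous_const).inter ?_
  have hc : Continuous fun V : Lp ℝ 2 m => (V, ((c - θ / 2 * ‖V‖ ^ 2 : ℝ) : EReal)) :=
    continuous_id.prodMk (continuous_coe_real_ereal.comp (by fun_prop))
  exact h.isClosed_epigraph.preimage hc

/-- On the proper domain `𝒦_θ` is finite, so the condition is a sublevel of a convex real function.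
-/
theorem convex_boundedPotentials {𝒦 : Lp ℝ 2 m → EReal} {θ : ℝ} (hbot : ∀ V, 𝒦 V ≠ ⊥)
    (h : IsSemiconvex 𝒦 θ) (c : ℝ) : Convex ℝ (boundedPotentials 𝒦 θ c) := by
  have hiff : ∀ V ∈ properDomain 𝒦, (penalized 𝒦 θ V ≤ (c : EReal) ↔
      (penalized 𝒦 θ V).toReal ≤ c) := fun V hV => by
    have h1 : penalized 𝒦 θ V ≠ ⊤ := EReal.add_ne_top (ne_of_lt hV) (EReal.coe_ne_top _)
    have h2 : penalized 𝒦 θ V ≠ ⊥ := by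
      rw [penalized, Ne, EReal.add_eq_bot_iff, not_or]
      exact ⟨hbot V, EReal.coe_ne_bot _⟩
    rw [← EReal.coe_le_coe_iff, EReal.coe_toReal h1 h2]
  have heq : boundedPotentials 𝒦 θ c = {V | ‖V‖ ≤ c} ∩
      {V ∈ properDomain 𝒦 | (penalized 𝒦 θ V).toReal ≤ c} := by
    ext V
    simp only [boundedPotentials, mem_ofPred_eq, mem_inter_iff]
    constructor
    · rintro ⟨h1, h2, h3⟩; exact ⟨h2, h1, (hiff V h1).1 h3⟩
    · rintro ⟨h2, h1, h3⟩; exact ⟨h1, h2, (hiff V h1).2 h3⟩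
  rw [heq]
  refine Convex.inter ?_ (ConvexOn.convex_le h c)
  simpa [Metric.closedBall, dist_zero_right] using convex_closedBall (0 : Lp ℝ 2 m) c

end Potentials

end SchrodingerEigen

/-! ### Assembly of the statement. -/

theorem lemma5p3
    {D : Type*} [MeasurableSpace D] (m : Measure D) [IsFiniteMeasure m]
    -- the Hilbert space, densely and compactly embedded in `L²`
    {𝕍 : Type*} [NormedAddCommGroup 𝕍] [InnerProductSpace ℝ 𝕍] [CompleteSpace 𝕍]
    (ι : 𝕍 →L[ℝ] Lp ℝ 2 m) (hι_inj : Function.Injective ι) (hι_dense : DenseRange ι)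
    (hι_compact : IsCompactOperator ι)
    -- the continuous, symmetric and coercive bilinear form
    (E : 𝕍 →L[ℝ] 𝕍 →L[ℝ] ℝ) (hE_symm : ∀ u v, E u v = E v u)
    (α M : ℝ) (hα : 0 ≤ α) (hM : 0 < M)
    (hE_lower : ∀ u, α * ‖ι u‖ ^ 2 ≤ E u u)
    (hE_coercive : ∀ u, M⁻¹ * ‖u‖ ^ 2 ≤ E u u + ‖ι u‖ ^ 2)
    (hE_bounded : ∀ u, E u u + ‖ι u‖ ^ 2 ≤ M * ‖u‖ ^ 2)
    -- the functional whose proper domain is the set of admissible potentials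
    (𝒦 : Lp ℝ 2 m → EReal) (θ Vmin : ℝ) (hθ : 0 ≤ θ)
    (h𝒦_ne_bot : ∀ V, 𝒦 V ≠ ⊥) (h𝒦_lsc : LowerSemicontinuous 𝒦)
    (h𝒦_convex : IsSemiconvex 𝒦 θ)
    (h𝒦_lower : ∀ V ∈ properDomain 𝒦, ∀ᵐ x ∂m, Vmin ≤ V x)
    -- a reference potential and the threshold `c₀` that it defines
    (V₀ : Lp ℝ 2 m) (hV₀ : V₀ ∈ properDomain 𝒦)
    (c₀ : ℝ) (hc₀ : (c₀ : EReal) = max ((‖V₀‖ : ℝ) : EReal) (penalized 𝒦 θ V₀))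
    -- `L⁴`-summability and relative compactness of the eigenfunctions
    (hL4 : ∀ V ∈ properDomain 𝒦, ∀ (lam : ℝ) (u : 𝕍),
      IsEigenfunction ι E V lam u → MemLp (ι u) 4 m)
    (hL4_compact : ∀ c ≥ c₀, ∀ Λ > α + Vmin,
      IsCompact (closure {f : Lp ℝ 4 m |
        ∃ u ∈ boundedEigenfunctions ι E 𝒦 θ c Λ, (f : D → ℝ) =ᵐ[m] ι u}))
    -- the number of eigenvalues, which the forms have room for
    (J : ℕ)
    (hJ : ∀ V ∈ properDomain 𝒦, (J : Cardinal) ≤ Module.rank ℝ (formDomain ι V)) :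
    ∀ k : ℕ, 1 ≤ k → k ≤ J →
      WeaklyContinuousOn (eigenvalue ι E k) (properDomain 𝒦) ∧
      WeaklyContinuousOn (eigenvalueSum ι E k) (properDomain 𝒦) ∧
      ConcaveOn ℝ (properDomain 𝒦) (eigenvalueSum ι E k) ∧
      ∀ c ≥ c₀,
        (∃ L : ℝ≥0, LipschitzOnWith L (eigenvalue ι E k) (boundedPotentials 𝒦 θ c)) ∧
        (∃ L : ℝ≥0, LipschitzOnWith L (eigenvalueSum ι E k) (boundedPotentials 𝒦 θ c)) ∧
        (boundedEigenSystems ι E 𝒦 θ J c).Nonempty ∧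
        IsCompact (boundedEigenSystemsL4 ι E 𝒦 θ J c) ∧
        (∀ w ∈ boundedEigenSystems ι E 𝒦 θ J c, ∀ i, MemLp (ι (w i)) 4 m) ∧
        (∀ V : Lp ℝ 2 m, IsLeast (partialEnergy ι E k V '' boundedEigenSystems ι E 𝒦 θ J c)
          (truncatedSum ι E 𝒦 θ J k c V)) ∧
        ConcaveOn ℝ univ (truncatedSum ι E 𝒦 θ J k c) ∧
        (∃ L : ℝ≥0, LipschitzWith L (truncatedSum ι E 𝒦 θ J k c)) ∧
        (∀ V ∈ properDomain 𝒦, eigenvalueSum ι E k V ≤ truncatedSum ι E 𝒦 θ J k c V) ∧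
        (∀ V ∈ boundedPotentials 𝒦 θ c,
          truncatedSum ι E 𝒦 θ J k c V = eigenvalueSum ι E k V) := by
  intro k hk hkJ
  have C : CoerciveForm ι E M := ⟨hι_inj, hι_compact, hE_symm, hM,
    fun u => (mul_nonneg hα (sq_nonneg _)).trans (hE_lower u), hE_coercive⟩
  have hK : ∀ V ∈ properDomain 𝒦, IsAdmissible ι E J Vmin V := fun V hV =>
    ⟨h𝒦_lower V hV, hL4 V hV, hJ V hV⟩
  refine ⟨C.weaklyContinuousOn_eigenvalue hK hk hkJ, C.weaklyContinuousOn_eigenvalueSum hK hkJ,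
    C.concaveOn_eigenvalueSum hK h𝒦_convex.1 hkJ, fun c hc => ?_⟩
  have hKc : ∀ V ∈ boundedPotentials 𝒦 θ c, IsAdmissible ι E J Vmin V := fun V hV => hK V hV.1
  have hbdd : ∀ V ∈ boundedPotentials 𝒦 θ c, ‖V‖ ≤ c := fun V hV => hV.2.1
  obtain ⟨S, hS, hKS⟩ := C.exists_isCompact_L4 hKc hbdd (hL4_compact c hc)
  have hV₀c : V₀ ∈ boundedPotentials 𝒦 θ c := by
    have hcc : (c₀ : EReal) ≤ c := EReal.coe_le_coe_iff.2 hc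
    refine ⟨hV₀, EReal.coe_le_coe_iff.1 ?_, ?_⟩
    · exact (le_max_left _ _).trans (hc₀.symm.le.trans hcc)
    · exact (le_max_right _ _).trans (hc₀.symm.le.trans hcc)
  have hne : (boundedEigenSystems ι E 𝒦 θ J c).Nonempty := by
    obtain ⟨w, hw⟩ := C.eigenSystems_nonempty (hK _ hV₀).boundedBelow (hK _ hV₀).rank
    exact ⟨w, mem_iUnion₂.2 ⟨V₀, hV₀c, hw⟩⟩
  have hcomp : IsCompact (eigenSystemsL4 ι E J (boundedPotentials 𝒦 θ c)) :=
    C.isCompact_eigenSystemsL4 hKc hbdd (convex_boundedPotentials h𝒦_ne_bot h𝒦_convex c)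
      (isClosed_boundedPotentials h𝒦_lsc θ c) hS hKS
  have hleast : ∀ V : Lp ℝ 2 m,
      IsLeast (partialEnergy ι E k V '' boundedEigenSystems ι E 𝒦 θ J c)
        (truncatedSum ι E 𝒦 θ J k c V) := isLeast_partialEnergy hKc hcomp hne k
  have hmem : ∀ w ∈ boundedEigenSystems ι E 𝒦 θ J c, ∀ i, MemLp (ι (w i)) 4 m := fun w hw i => by
    obtain ⟨V, hV, hwV⟩ := mem_iUnion₂.1 hw
    exact (hKc V hV).memLp_of_mem hwV i
  refine ⟨C.lipschitzOnWith_eigenvalue hKc hS hKS hk hkJ,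
    C.lipschitzOnWith_eigenvalueSum hKc hS hKS hkJ, hne, hcomp, hmem, hleast,
    ⟨convex_univ, fun V _ V' _ a b ha hb hab => ?_⟩, ?_, fun V hV => ?_, fun V hV => ?_⟩
  -- A minimizer at the convex combination is a competitor at both endpoints.
  · obtain ⟨w, hw, heq⟩ := (hleast (a • V + b • V')).1
    rw [← heq, partialEnergy_combo (hmem w hw) k V V' hab, smul_eq_mul, smul_eq_mul]
    exact add_le_add (mul_le_mul_of_nonneg_left ((hleast V).2 ⟨w, hw, rfl⟩) ha)
      (mul_le_mul_of_nonneg_left ((hleast V').2 ⟨w, hw, rfl⟩) hb)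
  · obtain ⟨N, hN⟩ := exists_bound_sqL4 hS
    refine ⟨J * N, LipschitzWith.of_le_add_mul _ fun V' V => ?_⟩
    obtain ⟨w, hw, heq⟩ := (hleast V).1
    obtain ⟨W, hW, hwW⟩ := mem_iUnion₂.1 hw
    obtain ⟨q, hq⟩ := exists_L4_representatives (hmem w hw)
    rw [← heq, dist_eq_norm]
    push_cast
    exact ((hleast V').2 ⟨w, hw, rfl⟩).trans (partialEnergy_le_add hq
      (fun i => hN _ (hKS W hW w hwW i _ (hq i))) k V V')
  · obtain ⟨w, hw, heq⟩ := (hleast V).1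
    obtain ⟨W, hW, hwW⟩ := mem_iUnion₂.1 hw
    rw [← heq]
    exact C.eigenvalueSum_le_of_mem (hK V hV) (hKc W hW) hkJ hwW
  -- For `V ∈ 𝕂[c]` its own systems are competitors and attain `σ_k(V)`; the other inequality is Ky
  -- Fan.
  · refine le_antisymm ?_ ?_
    · obtain ⟨w, hw⟩ := C.eigenSystems_nonempty (hKc V hV).boundedBelow (hKc V hV).rank
      rw [← (hKc V hV).boundedBelow.partialEnergy_eq hkJ hw]
      exact (hleast V).2 ⟨w, mem_iUnion₂.2 ⟨V, hV, hw⟩, rfl⟩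
    · obtain ⟨w, hw, heq⟩ := (hleast V).1
      obtain ⟨W, hW, hwW⟩ := mem_iUnion₂.1 hw
      rw [← heq]
      exact C.eigenvalueSum_le_of_mem (hKc V hV) (hKc W hW) hkJ hwW
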